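/- Fix $d$ and let $\mathcal X=\{x\in\mathbb R^d:\|x\|_2\le 1,\ x\ge 0\}$ (coordinatewise). For $x_1,\dots,x_n\in\mathcal X$ let $X=[x_1,\dots,x_n]^{\mathrm T}\in\mathbb R^{n\times d}$, and write $X\in\mathcal X^n$. A random symmetric matrix $Y=(y_{ij})\in\{0,1\}^{n\times n}$ satisfies $Y\sim\mathrm{RDPG}(X)$ if the entries $y_{ij}$, $1\le i\le j\le n$, are independent with $y_{ij}\sim\mathrm{Bernoulli}(x_i^{\mathrm T}x_j)$; put $p(y_{ij}\mid X)=(x_i^{\mathrm T}x_j)^{y_{ij}}(1-x_i^{\mathrm T}x_j)^{1-y_{ij}}$. Let $\pi_x$ be a probability density on $\mathbb R^d$ supported on $\mathcal X$ and bounded away from $0$ and $\infty$ over $\mathcal X$, and let the prior $\Pi$ on $\mathcal X^n$ be the law of $X$ when $x_1,\dots,x_n$ are independent with density $\pi_x$. For a true latent position matrix $X_0=[x_{01},\dots,x_{0n}]^{\mathrm T}$ the posterior distribution is $$\Pi(X\in A\mid Y)=\frac{N_n(A)}{N_n(\mathcal X^n)},\qquad N_n(A)=\int_A\prod_{i\le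 j}\frac{p(y_{ij}\mid X)}{p(y_{ij}\mid X_0)}\,\Pi(\mathrm dX),\qquad A\subset\mathcal X^n\text{ measurable.}$$ **Theorem.** Let $\Delta\in\mathbb R^{d\times d}$ be positive definite and let $\delta\in(0,1/2)$. There exist constants $M_1,M_2>0$, depending only on $d$, $\Delta$, $\delta$ and $\pi_x$, such that the following holds. For each $n$ let $X_0=X_0^{(n)}\in\mathcal X^n$, and suppose that $\frac1n X_0^{\mathrm T}X_0\to\Delta$ as $n\to\infty$ and that $\delta\le x_{0i}^{\mathrm T}x_{0j}\le 1-\delta$ for all $n$ and all $i,j\in\{1,\dots,n\}$. Then for all sufficiently large $n$, if $Y\sim\mathrm{RDPG}(X_0)$ and $\mathbb E_0$ denotes the expectation over $Y$, $$\mathbb E_0\Big\{\Pi\Big(\tfrac1n\|XX^{\mathrm T}-X_0X_0^{\mathrm T}\|_{\mathrm F}>\tfrac{M_1}{\sqrt n}\,\Big|\,Y\Big)\Big\}\le 8\exp\big(-\tfrac12 nd\big),$$ $$\mathbb E_0\Big\{\Pi\Big(\tfrac1n\inf_{W\in\mathbb O(d)}\|X-X_0W\|_{\mathrm F}^2>\tfrac{M_2}{n}\,\Big|\,Y\Big)\Big\}\le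 8\exp\big(-\tfrac12 nd\big),$$ where $\|\cdot\|_{\mathrm F}$ is the Frobenius norm and $\mathbb O(d)$ is the group of $d\times d$ orthogonal matrices. -/

import Mathlib

open MeasureTheory ProbabilityTheory Filter Topology
open scoped Matrix ENNReal

noncomputable section

/-- The space `𝒳 = {x ∈ ℝᵈ : ‖x‖₂ ≤ 1, x ≥ 0}` of latent positions. -/
def latentSpace (d : ℕ) : Set (EuclideanSpace ℝ (Fin d)) :=
  {x | ‖x‖ ≤ 1 ∧ ∀ k, 0 ≤ x k}

/-- The set `𝒳ⁿ` of all families `(x₁, …, xₙ)` of latent positions. -/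
def latentFamilies (n d : ℕ) : Set (Fin n → EuclideanSpace ℝ (Fin d)) :=
  {X | ∀ i, X i ∈ latentSpace d}

/-- The `n × d` matrix `X = [x₁, …, xₙ]ᵀ` whose rows are the given vectors. -/
def latentMatrix {n d : ℕ} (X : Fin n → EuclideanSpace ℝ (Fin d)) :
    Matrix (Fin n) (Fin d) ℝ :=
  Matrix.of fun i k => X i k

open scoped Matrix.Norms.Frobenius in
/-- The Frobenius norm of a real matrix. -/
def frobNorm {m n : ℕ} (A : Matrix (Fin m) (Fin n) ℝ) : ℝ := ‖A‖

/-- The random matrix `Y` with entries in `{0, 1}` (`true` stands for `1`) is the adjacency matrix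
of a random dot product graph with latent positions `X`: it is symmetric, and the entries `y i j`,
`i ≤ j`, are independent Bernoulli random variables with success probabilities `xᵢᵀ xⱼ`. -/
structure IsRDPG {Ω : Type*} [MeasurableSpace Ω] (P : Measure Ω) {n d : ℕ}
    (X : Fin n → EuclideanSpace ℝ (Fin d)) (Y : Ω → Matrix (Fin n) (Fin n) Bool) : Prop where
  symm : ∀ ω, (Y ω).IsSymm
  measurable : ∀ i j, Measurable fun ω => Y ω i j
  bernoulli : ∀ i j, i ≤ j → P {ω | Y ω i j = true} = ENNReal.ofReal (inner ℝ (X i) (X j))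
  indep : iIndepFun (fun (p : {p : Fin n × Fin n // p.1 ≤ p.2}) ω => Y ω p.1.1 p.1.2) P

/-- The Bernoulli likelihood `p(y ∣ X) = (xᵢᵀ xⱼ)^y (1 - xᵢᵀ xⱼ)^(1 - y)` of one entry `y = y i j`. -/
def edgeLikelihood {n d : ℕ} (X : Fin n → EuclideanSpace ℝ (Fin d)) (i j : Fin n) (y : Bool) : ℝ :=
  if y = true then inner ℝ (X i) (X j) else 1 - inner ℝ (X i) (X j)

/-- The likelihood ratio `∏_{i ≤ j} p(y i j ∣ X) / p(y i j ∣ X₀)`. -/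
def likelihoodRatio {n d : ℕ} (X₀ X : Fin n → EuclideanSpace ℝ (Fin d))
    (Y : Matrix (Fin n) (Fin n) Bool) : ℝ :=
  ∏ p : {p : Fin n × Fin n // p.1 ≤ p.2},
    edgeLikelihood X p.1.1 p.1.2 (Y p.1.1 p.1.2) / edgeLikelihood X₀ p.1.1 p.1.2 (Y p.1.1 p.1.2)

/-- `f` is a probability density (with respect to Lebesgue measure) supported on `𝒳` that is bounded
away from `0` and `∞` over `𝒳`. -/
structure IsPriorDensity {d : ℕ} (f : EuclideanSpace ℝ (Fin d) → ℝ) : Prop where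
  measurable : Measurable f
  eq_zero : ∀ x, x ∉ latentSpace d → f x = 0
  bounds : ∃ a b : ℝ, 0 < a ∧ ∀ x ∈ latentSpace d, a ≤ f x ∧ f x ≤ b
  lintegral_eq_one : ∫⁻ x, ENNReal.ofReal (f x) = 1

/-- The prior `Π`: the rows `x₁, …, xₙ` are independent with common density `f`. -/
def rdpgPrior (n : ℕ) {d : ℕ} (f : EuclideanSpace ℝ (Fin d) → ℝ) :
    Measure (Fin n → EuclideanSpace ℝ (Fin d)) :=
  Measure.pi fun _ => volume.withDensity fun x => ENNReal.ofReal (f x)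

/-- `N_n(A) = ∫_A ∏_{i ≤ j} p(y i j ∣ X) / p(y i j ∣ X₀) Π(dX)`. -/
def evidence {n d : ℕ} (f : EuclideanSpace ℝ (Fin d) → ℝ)
    (X₀ : Fin n → EuclideanSpace ℝ (Fin d)) (Y : Matrix (Fin n) (Fin n) Bool)
    (A : Set (Fin n → EuclideanSpace ℝ (Fin d))) : ℝ≥0∞ :=
  ∫⁻ X in A, ENNReal.ofReal (likelihoodRatio X₀ X Y) ∂(rdpgPrior n f)

/-- The posterior probability `Π(X ∈ A ∣ Y) = N_n(A) / D_n`, where `D_n = N_n(𝒳ⁿ)`. -/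
def rdpgPosterior {n d : ℕ} (f : EuclideanSpace ℝ (Fin d) → ℝ)
    (X₀ : Fin n → EuclideanSpace ℝ (Fin d)) (Y : Matrix (Fin n) (Fin n) Bool)
    (A : Set (Fin n → EuclideanSpace ℝ (Fin d))) : ℝ≥0∞ :=
  evidence f X₀ Y A / evidence f X₀ Y (latentFamilies n d)

/-- `(1/n) ‖X Xᵀ - X₀ X₀ᵀ‖_F`. -/
def gramLoss {n d : ℕ} (X X₀ : Fin n → EuclideanSpace ℝ (Fin d)) : ℝ :=
  (1 / (n : ℝ)) *
    frobNorm (latentMatrix X * (latentMatrix X)ᵀ - latentMatrix X₀ * (latentMatrix X₀)ᵀ)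

/-- `(1/n) inf_{W ∈ 𝕆(d)} ‖X - X₀ W‖_F²`. -/
def procrustesLoss {n d : ℕ} (X X₀ : Fin n → EuclideanSpace ℝ (Fin d)) : ℝ :=
  (1 / (n : ℝ)) * ⨅ W : Matrix.orthogonalGroup (Fin d) ℝ,
    frobNorm (latentMatrix X - latentMatrix X₀ * (W : Matrix (Fin d) (Fin d) ℝ)) ^ 2

end

/-!
Write `D = X Xᵀ - X₀ X₀ᵀ`. The posterior mass of `{‖D‖_F > M √n}` is bounded by testing, and no
covering of the parameter space is needed, because a single test works for all alternatives.

*The test.* Reject `X₀` if `|vᵀ (Y - X₀ X₀ᵀ) v| ≥ K √n` for some `v` in a finite net of the unit ball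
of `ℝⁿ`, of cardinality `exp (C n)` (`exists_net_unitBall`). By Hoeffding's inequality and a union
bound the error of the first kind is at most `exp (C n - K² n / 8)` (`sum_rejectSet_le`). The matrix
`D` is symmetric of rank at most `2 d`, so some unit eigenvector, hence some nearby point of the net,
satisfies `|vᵀ D v| ≥ c ‖D‖_F` (`exists_unit_forall_near_frobNorm_le`); this single `v` bounds the
error of the second kind at `X` by `2 exp (-c' ‖D‖_F²)` as soon as `‖D‖_F` exceeds a multiple of
`K √n` (`sum_compl_rejectSet_le`).

*The denominator.* On the product `B` of cubes of side of order `1 / √n` with lower corners at the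
true positions, the second moment of the likelihood ratio is at most `exp n`
(`sum_bernoulliWeight_sq_div_le_exp`). By the Cauchy-Schwarz and Markov inequalities the denominator
is at least `Π(B) exp (-n - n d)` up to an event of probability `exp (-n d)`
(`sum_mul_posterior_le`), and `Π(B) ≥ (C / √n) ^ (n d)` (`le_rdpgPrior_cornerNhd`).

*The numerator.* There is no logarithmic loss because the prior integral of the errors of the second
kind is of the same order `(C / √n) ^ (n d)`. The alignment inequality
`σ / 2 * ‖X - X₀ W‖_F² ≤ ‖D‖_F²`, for some orthogonal `W` and `X₀ᵀ X₀ ≥ σ`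
(`exists_orthogonal_frobNorm_sub_le`), is applied with `σ` of order `n`: after rounding `W` to a
grid of polynomially many matrices, `exp (-c' ‖D‖_F²)` is dominated by a sum of Gaussians in `X` with
variances of order `1 / n` (`lintegral_exp_neg_gramDiff_le`). The powers of `√n` cancel and `K`
large makes all errors small (`rate_bound`).

The second bound follows from the first, since the alignment inequality bounds the Procrustes loss by
a multiple of the squared gram loss (`procrustesLoss_le`).
-/

noncomputable section

/-! ### Procrustes alignment -/

open scoped Matrix.Norms.Frobenius in
lemma frobNorm_sq_eq_sum {m n : ℕ} (A : Matrix (Fin m) (Fin n) ℝ) :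
    frobNorm A ^ 2 = ∑ i, ∑ j, A i j ^ 2 := by
  rw [frobNorm, Matrix.frobenius_norm_def, ← Real.sqrt_eq_rpow, Real.sq_sqrt (by positivity)]
  simp

lemma frobNorm_nonneg {m n : ℕ} (A : Matrix (Fin m) (Fin n) ℝ) : 0 ≤ frobNorm A :=
  @norm_nonneg _ (Matrix.frobeniusSeminormedAddCommGroup.toSeminormedAddGroup) A

lemma frobNorm_sq_eq_trace {m n : ℕ} (A : Matrix (Fin m) (Fin n) ℝ) :
    frobNorm A ^ 2 = (Aᵀ * A).trace := by
  rw [frobNorm_sq_eq_sum, Finset.sum_comm]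
  simp [Matrix.trace, Matrix.mul_apply, sq]

lemma entry_mem_Icc_of_orthogonal {d : ℕ} {W : Matrix (Fin d) (Fin d) ℝ} (hW : Wᵀ * W = 1)
    (i j : Fin d) : -1 ≤ W i j ∧ W i j ≤ 1 := by
  have h : ∑ k, W k j * W k j = 1 := by
    have := congrFun (congrFun hW j) j
    rw [Matrix.mul_apply] at this
    simpa using this
  have h2 : W i j * W i j ≤ 1 := by
    rw [← h]
    exact Finset.single_le_sum (f := fun k => W k j * W k j)
      (fun k _ => mul_self_nonneg _) (Finset.mem_univ i)
  exact ⟨by nlinarith, by nlinarith⟩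

lemma isCompact_orthogonal (d : ℕ) :
    IsCompact {Q : Matrix (Fin d) (Fin d) ℝ | Qᵀ * Q = 1} := by
  have hK : IsCompact (Set.pi Set.univ fun _ : Fin d => Set.pi Set.univ fun _ : Fin d =>
      Set.Icc (-1 : ℝ) 1) :=
    isCompact_univ_pi fun _ => isCompact_univ_pi fun _ => isCompact_Icc
  refine hK.of_isClosed_subset (isClosed_eq (by fun_prop) continuous_const) ?_
  exact fun Q hQ i _ j _ => entry_mem_Icc_of_orthogonal hQ i j

/-- A matrix whose trace does not increase under multiplication by any orthogonal matrix is
positive semidefinite: reflections give nonnegativity, plane rotations give symmetry. -/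
lemma posSemidef_of_trace_mul_le {d : ℕ} {N : Matrix (Fin d) (Fin d) ℝ}
    (h : ∀ Q : Matrix (Fin d) (Fin d) ℝ, Qᵀ * Q = 1 → (N * Q).trace ≤ N.trace) :
    N.PosSemidef := by
  have hsymm : ∀ i j, N i j = N j i := by
    intro i j
    by_cases hij : i = j
    · rw [hij]
    set a := N i i + N j j
    set b := N i j - N j i
    by_contra hne
    have hb : b ≠ 0 := sub_ne_zero.2 hne
    set r := Real.sqrt (a ^ 2 + b ^ 2)
    have hr2 : r ^ 2 = a ^ 2 + b ^ 2 := Real.sq_sqrt (by positivity)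
    have hb2 : 0 < b ^ 2 := by positivity
    have hr : 0 < r := Real.sqrt_pos.2 (by positivity)
    -- the rotation by the angle with cosine `a / r` and sine `b / r` in the plane `(i, j)`
    set c := a / r
    set s := b / r
    have hcs : c ^ 2 + s ^ 2 = 1 := by
      simp only [c, s, div_pow, hr2]
      field_simp
    set P : Matrix (Fin d) (Fin d) ℝ := Matrix.single i i 1 + Matrix.single j j 1
    set J : Matrix (Fin d) (Fin d) ℝ := Matrix.single j i 1 - Matrix.single i j 1
    have hji : j ≠ i := fun h => hij h.symm
    have hPP : P * P = P := by
      simp [P, mul_add, add_mul, hij, hji]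
    have hPJ : P * J = J := by
      simp [P, J, mul_sub, add_mul, hij, hji]
    have hJP : J * P = J := by
      simp [P, J, mul_add, sub_mul, hij, hji]; abel
    have hJJ : J * J = -P := by
      simp [P, J, mul_sub, sub_mul, hij, hji]; abel
    have hPt : Pᵀ = P := by simp [P]
    have hJt : Jᵀ = -J := by simp [J]
    have hQ := h (1 + (c - 1) • P + s • J) (by
      simp only [Matrix.transpose_add, Matrix.transpose_smul, hPt, hJt, Matrix.transpose_one,
        add_mul, mul_add, smul_mul_assoc, mul_smul_comm, hPP, hPJ, hJP, hJJ, one_mul, mul_one,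
        neg_mul]
      have : (1 : Matrix (Fin d) (Fin d) ℝ) = 1 + (c ^ 2 + s ^ 2 - 1) • P := by simp [hcs]
      conv_rhs => rw [this]
      module)
    have htr : (N * (1 + (c - 1) • P + s • J)).trace = N.trace + (c - 1) * a + s * b := by
      simp [P, J, a, b, mul_add, mul_sub, Matrix.trace_add, Matrix.trace_sub, Matrix.trace_smul,
        Matrix.trace_mul_single]
      ring
    rw [htr] at hQ
    have h3 : c * a + s * b = r := by
      simp only [c, s]
      field_simp
      linarith
    have h4 : r ≤ a := by linarith
    nlinarith
  refine Matrix.PosSemidef.of_dotProduct_mulVec_nonneg (Matrix.IsHermitian.ext fun i j => ?_) ?_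
  · simpa using hsymm j i
  intro v
  simp only [star_trivial]
  by_cases hv : v = 0
  · simp [hv]
  have hs : 0 < v ⬝ᵥ v := by simpa using Matrix.dotProduct_star_self_pos_iff.2 hv
  -- the reflection in the hyperplane orthogonal to `v`
  have hQ := h (1 - (2 / (v ⬝ᵥ v)) • Matrix.vecMulVec v v) (by
    simp only [Matrix.transpose_sub, Matrix.transpose_smul, Matrix.transpose_one,
      Matrix.transpose_vecMulVec, sub_mul, mul_sub, smul_mul_assoc, mul_smul_comm, one_mul, mul_one,
      Matrix.vecMulVec_mul_vecMulVec, Matrix.vecMulVec_smul]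
    have : 2 / (v ⬝ᵥ v) * (2 / (v ⬝ᵥ v) * (v ⬝ᵥ v)) = 2 / (v ⬝ᵥ v) + 2 / (v ⬝ᵥ v) := by
      field_simp; norm_num
    rw [smul_sub, smul_smul, smul_smul, mul_assoc, this]
    module)
  have htr : (N * (1 - (2 / (v ⬝ᵥ v)) • Matrix.vecMulVec v v)).trace
      = N.trace - 2 / (v ⬝ᵥ v) * (v ⬝ᵥ N *ᵥ v) := by
    rw [mul_sub, mul_one, Matrix.mul_smul, Matrix.mul_vecMulVec, Matrix.trace_sub,
      Matrix.trace_smul, Matrix.trace_vecMulVec, dotProduct_comm v (N *ᵥ v),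
      smul_eq_mul]
  rw [htr] at hQ
  have h5 : 0 ≤ 2 / (v ⬝ᵥ v) * (v ⬝ᵥ N *ᵥ v) := by linarith
  exact nonneg_of_mul_nonneg_right h5 (by positivity)

/-- The polar decomposition, as much as is needed of it: every square matrix becomes positive
semidefinite after multiplication by a suitable orthogonal matrix. -/
lemma exists_orthogonal_mul_posSemidef {d : ℕ} (M : Matrix (Fin d) (Fin d) ℝ) :
    ∃ W : Matrix (Fin d) (Fin d) ℝ, Wᵀ * W = 1 ∧ (M * W).PosSemidef := by
  obtain ⟨W, hW, hmax⟩ := (isCompact_orthogonal d).exists_isMaxOn ⟨1, by simp⟩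
    (f := fun W => (M * W).trace) (by fun_prop)
  refine ⟨W, hW, posSemidef_of_trace_mul_le fun Q hQ => ?_⟩
  have hQ' : (W * Q)ᵀ * (W * Q) = 1 := by
    rw [Matrix.transpose_mul, Matrix.mul_assoc, ← Matrix.mul_assoc Wᵀ, hW, one_mul, hQ]
  have := hmax hQ'
  simpa [Matrix.mul_assoc] using this

lemma trace_mul_nonneg_of_posSemidef {m n : ℕ} (H : Matrix (Fin m) (Fin n) ℝ)
    {B : Matrix (Fin n) (Fin n) ℝ} (hB : B.PosSemidef) : 0 ≤ (Hᵀ * H * B).trace := by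
  have h := (hB.mul_mul_conjTranspose_same H).trace_nonneg
  rw [Matrix.conjTranspose_eq_transpose_of_trivial] at h
  rwa [Matrix.mul_assoc, Matrix.trace_mul_comm]

/-- If the Gram matrix of `Z` is at least `σ`, then `X` can be aligned with `Z` at a cost controlled
by the distance between `X Xᵀ` and `Z Zᵀ`. -/
lemma exists_orthogonal_frobNorm_sub_le {n d : ℕ} (X Z : Matrix (Fin n) (Fin d) ℝ) {σ : ℝ}
    (hZ : (Zᵀ * Z - σ • (1 : Matrix (Fin d) (Fin d) ℝ)).PosSemidef) :
    ∃ W : Matrix (Fin d) (Fin d) ℝ, Wᵀ * W = 1 ∧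
      σ / 2 * frobNorm (X - Z * W) ^ 2 ≤ frobNorm (X * Xᵀ - Z * Zᵀ) ^ 2 := by
  obtain ⟨W, hW, hpsd⟩ := exists_orthogonal_mul_posSemidef (Xᵀ * Z)
  have hW' : W * Wᵀ = 1 := mul_eq_one_comm.1 hW
  refine ⟨W, hW, ?_⟩
  -- With `T = Hᵀ H`, `B = Xᵀ U` positive semidefinite and `G = Uᵀ U`, the right-hand side equals
  -- `tr (T + (5/4) (B - G))² + (3/2) tr (T B) + (7/16) tr (B - G)² + (1/2) tr (T G)`.
  set U := Z * W with hU
  set B := Xᵀ * U with hBdef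
  set G := Uᵀ * U with hGdef
  set H := X - U with hHdef
  have hBpsd : B.PosSemidef := by rwa [hBdef, hU, ← Matrix.mul_assoc]
  have hBt : Bᵀ = B := by
    have h : B.IsSymm := by simpa using hBpsd.isHermitian
    exact h
  have hUX : Uᵀ * X = B := by
    have h := Matrix.transpose_mul Xᵀ U
    rw [Matrix.transpose_transpose, ← hBdef, hBt] at h
    exact h.symm
  have hUU : Z * Zᵀ = U * Uᵀ := by
    rw [hU, Matrix.transpose_mul, Matrix.mul_assoc, ← Matrix.mul_assoc W, hW', Matrix.one_mul]
  have hGσ : (G - σ • (1 : Matrix (Fin d) (Fin d) ℝ)).PosSemidef := by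
    have h := hZ.conjTranspose_mul_mul_same W
    rw [Matrix.conjTranspose_eq_transpose_of_trivial] at h
    have heq : Wᵀ * (Zᵀ * Z - σ • (1 : Matrix (Fin d) (Fin d) ℝ)) * W = G - σ • 1 := by
      simp only [mul_sub, sub_mul, hGdef, hU, Matrix.transpose_mul, Matrix.mul_assoc,
        Matrix.smul_mul, Matrix.mul_smul, one_mul, hW]
    rwa [heq] at h
  set T := Hᵀ * H with hT
  have hP : Xᵀ * X = T + (2 : ℝ) • B - G := by
    rw [hT, hHdef, Matrix.transpose_sub, Matrix.sub_mul, Matrix.mul_sub, Matrix.mul_sub, hUX]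
    rw [two_smul]; abel
  have hTB : 0 ≤ (T * B).trace := trace_mul_nonneg_of_posSemidef H hBpsd
  have hTG : σ * T.trace ≤ (T * G).trace := by
    have h := trace_mul_nonneg_of_posSemidef H hGσ
    rw [← hT, Matrix.mul_sub, Matrix.trace_sub, Matrix.mul_smul, Matrix.trace_smul, mul_one,
      smul_eq_mul] at h
    linarith
  have hTt : Tᵀ = T := by rw [hT, Matrix.transpose_mul, Matrix.transpose_transpose]
  have hGt : Gᵀ = G := by rw [hGdef, Matrix.transpose_mul, Matrix.transpose_transpose]
  have hA2 : 0 ≤ ((B - G) * (B - G)).trace := by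
    have h : 0 ≤ frobNorm (B - G) ^ 2 := sq_nonneg _
    rwa [frobNorm_sq_eq_trace, Matrix.transpose_sub, hBt, hGt] at h
  have hS2 : 0 ≤ ((T + (5 / 4 : ℝ) • (B - G)) * (T + (5 / 4 : ℝ) • (B - G))).trace := by
    have h : 0 ≤ frobNorm (T + (5 / 4 : ℝ) • (B - G)) ^ 2 := sq_nonneg _
    rwa [frobNorm_sq_eq_trace, Matrix.transpose_add, Matrix.transpose_smul, Matrix.transpose_sub,
      hBt, hGt, hTt] at h
  have hD : frobNorm (X * Xᵀ - Z * Zᵀ) ^ 2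
      = (Xᵀ * X * (Xᵀ * X)).trace - 2 * (B * B).trace + (G * G).trace := by
    rw [frobNorm_sq_eq_trace, hUU]
    simp only [Matrix.transpose_sub, Matrix.transpose_mul, Matrix.transpose_transpose,
      Matrix.sub_mul, Matrix.mul_sub, Matrix.trace_sub]
    have e1 : (X * Xᵀ * (X * Xᵀ)).trace = (Xᵀ * X * (Xᵀ * X)).trace := by
      rw [Matrix.mul_assoc, Matrix.trace_mul_comm]; simp only [Matrix.mul_assoc]
    have e2 : (U * Uᵀ * (U * Uᵀ)).trace = (G * G).trace := by
      rw [hGdef, Matrix.mul_assoc, Matrix.trace_mul_comm]; simp only [Matrix.mul_assoc]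
    have e3 : (X * Xᵀ * (U * Uᵀ)).trace = (B * B).trace := by
      nth_rewrite 2 [← hUX]
      rw [hBdef, Matrix.mul_assoc, Matrix.trace_mul_comm]; simp only [Matrix.mul_assoc]
    have e4 : (U * Uᵀ * (X * Xᵀ)).trace = (B * B).trace := by
      rw [Matrix.trace_mul_comm, e3]
    rw [e1, e2, e3, e4]; ring
  rw [hD, frobNorm_sq_eq_trace, ← hT, hP]
  simp only [Matrix.add_mul, Matrix.mul_add, Matrix.sub_mul, Matrix.mul_sub, Matrix.trace_add,
    Matrix.trace_sub, Matrix.smul_mul, Matrix.mul_smul, Matrix.trace_smul, smul_eq_mul,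
    Matrix.trace_mul_comm B T, Matrix.trace_mul_comm G T, Matrix.trace_mul_comm G B]
    at hA2 hS2 hTB hTG ⊢
  linarith

/-! ### Symmetric matrices of low rank -/

lemma rank_mul_transpose_sub_le {n d : ℕ} (X Z : Matrix (Fin n) (Fin d) ℝ) :
    (X * Xᵀ - Z * Zᵀ).rank ≤ 2 * d := by
  have h : X * Xᵀ - Z * Zᵀ = Matrix.fromCols X Z * Matrix.fromRows Xᵀ (-Zᵀ) := by
    rw [Matrix.fromCols_mul_fromRows, Matrix.mul_neg, sub_eq_add_neg]
  rw [h]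
  refine (Matrix.rank_mul_le_left _ _).trans ((Matrix.rank_le_card_width _).trans ?_)
  simp [two_mul]

/-- A symmetric matrix of rank at most `r` has an eigenvalue that carries at least a fraction
`1 / r` of the squared Frobenius norm. -/
lemma exists_eigenvector_frobNorm_sq_le {n r : ℕ} {D : Matrix (Fin n) (Fin n) ℝ}
    (hD : D.IsHermitian) (hr : D.rank ≤ r) (hD0 : D ≠ 0) :
    ∃ (u : Fin n → ℝ) (l : ℝ), u ⬝ᵥ u = 1 ∧ D *ᵥ u = l • u ∧ frobNorm D ^ 2 ≤ r * l ^ 2 := by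
  have htr : frobNorm D ^ 2 = ∑ i, hD.eigenvalues i ^ 2 := by
    rw [frobNorm_sq_eq_trace]
    have hDt : D.IsSymm := by simpa using hD
    rw [hDt.eq]
    conv_lhs => rw [hD.spectral_theorem, ← map_mul, Unitary.conjStarAlgAut_apply,
      Matrix.trace_mul_comm, ← Matrix.mul_assoc]
    simp [Matrix.diagonal_mul_diagonal, Matrix.trace_diagonal, sq]
  have hne : Nonempty (Fin n) := by
    by_contra h
    exact hD0 (Matrix.ext fun i => (h ⟨i⟩).elim)
  obtain ⟨k, hk⟩ := Finite.exists_max fun i => hD.eigenvalues i ^ 2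
  refine ⟨hD.eigenvectorBasis k, hD.eigenvalues k, ?_, hD.mulVec_eigenvectorBasis k, ?_⟩
  · have h := hD.eigenvectorBasis.orthonormal.1 k
    have h2 : ‖hD.eigenvectorBasis k‖ ^ 2 = 1 := by rw [h]; norm_num
    rw [EuclideanSpace.norm_sq_eq] at h2
    simpa [dotProduct, sq] using h2
  · rw [htr]
    calc ∑ i, hD.eigenvalues i ^ 2
        = ∑ i with hD.eigenvalues i ≠ 0, hD.eigenvalues i ^ 2 := by
          rw [Finset.sum_filter_of_ne]; intro i _ hi h; simp [h] at hi
      _ ≤ (Finset.univ.filter fun i => hD.eigenvalues i ≠ 0).card • hD.eigenvalues k ^ 2 :=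
          Finset.sum_le_card_nsmul _ _ _ fun i _ => hk i
      _ ≤ r * hD.eigenvalues k ^ 2 := by
          rw [nsmul_eq_mul]
          have hc := hD.rank_eq_card_non_zero_eigs
          rw [Fintype.card_subtype] at hc
          gcongr
          omega

lemma abs_dotProduct_mulVec_le {n : ℕ} (D : Matrix (Fin n) (Fin n) ℝ) (h : Fin n → ℝ) :
    |h ⬝ᵥ D *ᵥ h| ≤ frobNorm D * (h ⬝ᵥ h) := by
  refine abs_le_of_sq_le_sq ?_ (mul_nonneg (frobNorm_nonneg D)
    (Finset.sum_nonneg fun i _ => mul_self_nonneg _))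
  have h1 : h ⬝ᵥ D *ᵥ h = ∑ p : Fin n × Fin n, D p.1 p.2 * (h p.1 * h p.2) := by
    rw [Fintype.sum_prod_type]
    simp only [dotProduct, Matrix.mulVec, Finset.mul_sum]
    exact Finset.sum_congr rfl fun i _ => Finset.sum_congr rfl fun j _ => by ring
  have h2 : frobNorm D ^ 2 = ∑ p : Fin n × Fin n, D p.1 p.2 ^ 2 := by
    rw [Fintype.sum_prod_type, frobNorm_sq_eq_sum]
  have h3 : (h ⬝ᵥ h) ^ 2 = ∑ p : Fin n × Fin n, (h p.1 * h p.2) ^ 2 := by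
    rw [Fintype.sum_prod_type, sq, dotProduct, Finset.sum_mul_sum]
    exact Finset.sum_congr rfl fun i _ => Finset.sum_congr rfl fun j _ => by ring
  rw [h1, mul_pow, h2, h3]
  exact Finset.sum_mul_sq_le_sq_mul_sq _ _ _

/-- The quadratic form of a symmetric matrix of rank at most `r` is comparable with its Frobenius
norm at every vector close to its leading eigenvector. -/
lemma exists_unit_forall_near_frobNorm_le {n r : ℕ} {D : Matrix (Fin n) (Fin n) ℝ}
    (hD : D.IsHermitian) (hr1 : 1 ≤ r) (hr : D.rank ≤ r) (hD0 : D ≠ 0) :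
    ∃ u : Fin n → ℝ, u ⬝ᵥ u = 1 ∧
      ∀ v : Fin n → ℝ, (v - u) ⬝ᵥ (v - u) ≤ (1 / (4 * r : ℝ)) ^ 2 →
        frobNorm D ≤ 4 * r * |v ⬝ᵥ D *ᵥ v| := by
  obtain ⟨u, l, hu, hDu, hl⟩ := exists_eigenvector_frobNorm_sq_le hD hr hD0
  refine ⟨u, hu, fun v hv => ?_⟩
  have hr1' : (1 : ℝ) ≤ r := by exact_mod_cast hr1
  have hDt : D.IsSymm := by simpa using hD
  have hF : frobNorm D ≤ r * |l| := by
    refine abs_le_of_sq_le_sq' ?_ (by positivity) |>.2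
    rw [mul_pow, sq_abs]
    nlinarith [sq_nonneg l]
  set h := v - u with hh
  have hvu : v = u + h := by rw [hh]; abel
  have huD : u ⬝ᵥ D *ᵥ h = l * (u ⬝ᵥ h) := by
    rw [Matrix.dotProduct_mulVec, ← Matrix.mulVec_transpose, hDt.eq, hDu, smul_dotProduct, smul_eq_mul]
  have hexp : v ⬝ᵥ D *ᵥ v = l + 2 * l * (u ⬝ᵥ h) + h ⬝ᵥ D *ᵥ h := by
    rw [hvu, Matrix.mulVec_add, add_dotProduct, dotProduct_add, dotProduct_add, huD, hDu,
      dotProduct_smul, dotProduct_smul, hu, dotProduct_comm h u, smul_eq_mul, smul_eq_mul]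
    ring
  have hq := abs_dotProduct_mulVec_le D h
  have hhh : 0 ≤ h ⬝ᵥ h := Finset.sum_nonneg fun i _ => mul_self_nonneg _
  have huh : |u ⬝ᵥ h| ≤ 1 / (4 * r) := by
    refine abs_le_of_sq_le_sq ?_ (by positivity)
    refine le_trans ?_ hv
    have := Finset.sum_mul_sq_le_sq_mul_sq Finset.univ u h
    simp only [dotProduct, ← sq] at hu ⊢
    simpa [hu] using this
  have hl0 := abs_nonneg l
  have e1 : |2 * l * (u ⬝ᵥ h)| ≤ |l| / 2 := by
    rw [abs_mul, abs_mul, abs_two]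
    have : |u ⬝ᵥ h| ≤ 1 / 4 := huh.trans (by gcongr; linarith)
    nlinarith
  have e2 : |h ⬝ᵥ D *ᵥ h| ≤ |l| / 4 := by
    refine hq.trans ((mul_le_mul hF hv hhh (by positivity)).trans ?_)
    have : r * |l| * (1 / (4 * r : ℝ)) ^ 2 = |l| / 16 * (1 / r) := by field_simp; norm_num
    rw [this]
    have : 1 / (r : ℝ) ≤ 1 := by rw [div_le_one (by linarith)]; exact hr1'
    nlinarith
  have e3 : |l| / 4 ≤ |v ⬝ᵥ D *ᵥ v| := by
    rw [hexp]
    have a1 : |l| ≤ |l + 2 * l * (u ⬝ᵥ h) + h ⬝ᵥ D *ᵥ h| + |2 * l * (u ⬝ᵥ h)| +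
        |h ⬝ᵥ D *ᵥ h| := by
      have := abs_sub (l + 2 * l * (u ⬝ᵥ h) + h ⬝ᵥ D *ᵥ h) (2 * l * (u ⬝ᵥ h) + h ⬝ᵥ D *ᵥ h)
      have h7 := abs_add_le (2 * l * (u ⬝ᵥ h)) (h ⬝ᵥ D *ᵥ h)
      have h8 : l + 2 * l * (u ⬝ᵥ h) + h ⬝ᵥ D *ᵥ h - (2 * l * (u ⬝ᵥ h) + h ⬝ᵥ D *ᵥ h) = l := by
        ring
      rw [h8] at this
      linarith
    linarith
  nlinarith

/-! ### A net of the unit ball -/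

lemma exists_int_abs_le_abs (x : ℝ) : ∃ z : ℤ, |(z : ℝ)| ≤ |x| ∧ |z - x| ≤ 1 := by
  rcases le_total 0 x with hx | hx
  · refine ⟨⌊x⌋, ?_, ?_⟩
    · have h : (0 : ℝ) ≤ ⌊x⌋ := by exact_mod_cast Int.floor_nonneg.2 hx
      rw [abs_of_nonneg h, abs_of_nonneg hx]
      exact Int.floor_le x
    · rw [abs_le]
      constructor <;> linarith [Int.floor_le x, Int.lt_floor_add_one x]
  · refine ⟨⌈x⌉, ?_, ?_⟩
    · have h : (⌈x⌉ : ℝ) ≤ 0 := by exact_mod_cast Int.ceil_nonpos.2 hx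
      rw [abs_of_nonpos h, abs_of_nonpos hx]
      linarith [Int.le_ceil x]
    · rw [abs_le]
      constructor <;> linarith [Int.le_ceil x, Int.ceil_lt_add_one x]

lemma sum_Icc_half_pow_natAbs (m : ℕ) :
    ∑ k ∈ Finset.Icc (-(m : ℤ)) m, (1 / 2 : ℝ) ^ k.natAbs = 3 - 2 * (1 / 2) ^ m := by
  induction m with
  | zero => norm_num
  | succ m ih =>
    have h : Finset.Icc (-((m + 1 : ℕ) : ℤ)) ((m + 1 : ℕ) : ℤ)
        = insert (-((m + 1 : ℕ) : ℤ)) (insert ((m + 1 : ℕ) : ℤ) (Finset.Icc (-(m : ℤ)) m)) := by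
      ext k
      simp only [Finset.mem_Icc, Finset.mem_insert]
      omega
    rw [h, Finset.sum_insert, Finset.sum_insert, ih, Int.natAbs_neg, Int.natAbs_natCast, pow_succ]
    · ring
    · simp only [Finset.mem_Icc]; omega
    · simp only [Finset.mem_insert, Finset.mem_Icc]; omega

/-- Integer vectors of small `ℓ¹` norm are counted with the weights `2 ^ (-|z₁| - ⋯ - |zₙ|)`. -/
lemma card_le_of_sum_natAbs_le {n : ℕ} (m : ℕ) (S : Finset (Fin n → ℤ))
    (hS : ∀ z ∈ S, ∑ i, (z i).natAbs ≤ m) : (S.card : ℝ) ≤ 2 ^ m * 3 ^ n := by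
  have hsub : S ⊆ Fintype.piFinset fun _ => Finset.Icc (-(m : ℤ)) m := by
    intro z hz
    rw [Fintype.mem_piFinset]
    intro i
    have h := (Finset.single_le_sum (f := fun i => (z i).natAbs) (fun i _ => Nat.zero_le _)
      (Finset.mem_univ i)).trans (hS z hz)
    rw [Finset.mem_Icc]
    omega
  calc (S.card : ℝ) = ∑ z ∈ S, 1 := by simp
    _ ≤ ∑ z ∈ S, 2 ^ m * ∏ i, (1 / 2 : ℝ) ^ (z i).natAbs := by
        refine Finset.sum_le_sum fun z hz => ?_
        rw [Finset.prod_pow_eq_pow_sum, one_div, inv_pow, ← div_eq_mul_inv, one_le_div (by positivity)]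
        exact pow_le_pow_right₀ (by norm_num) (hS z hz)
    _ ≤ ∑ z ∈ Fintype.piFinset fun _ => Finset.Icc (-(m : ℤ)) m,
          2 ^ m * ∏ i, (1 / 2 : ℝ) ^ (z i).natAbs :=
        Finset.sum_le_sum_of_subset_of_nonneg hsub fun _ _ _ => by positivity
    _ = 2 ^ m * ∏ _i : Fin n, ∑ k ∈ Finset.Icc (-(m : ℤ)) m, (1 / 2 : ℝ) ^ k.natAbs := by
        rw [← Finset.mul_sum, Finset.prod_univ_sum]
    _ ≤ 2 ^ m * ∏ _i : Fin n, 3 := by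
        gcongr
        rw [sum_Icc_half_pow_natAbs]
        linarith [show (0 : ℝ) < 2 * (1 / 2) ^ m by positivity]
    _ = 2 ^ m * 3 ^ n := by simp

/-- The unit ball of `ℝⁿ` has a `1 / L`-net of cardinality exponential in `n`: the points of the
lattice `(L √n)⁻¹ ℤⁿ` inside the ball. -/
lemma exists_net_unitBall (n L : ℕ) (hL : 1 ≤ L) :
    ∃ N : Finset (Fin n → ℝ), (N.card : ℝ) ≤ (3 * 2 ^ L) ^ n ∧ (∀ v ∈ N, v ⬝ᵥ v ≤ 1) ∧
      ∀ u : Fin n → ℝ, u ⬝ᵥ u ≤ 1 → ∃ v ∈ N, (v - u) ⬝ᵥ (v - u) ≤ (1 / L : ℝ) ^ 2 := by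
  classical
  rcases Nat.eq_zero_or_pos n with rfl | hn
  · exact ⟨{0}, by simp, by simp, fun u _ => ⟨0, by simp, by simp⟩⟩
  have hn' : (0 : ℝ) < n := by exact_mod_cast hn
  have hL' : (0 : ℝ) < L := by exact_mod_cast hL
  set r : ℝ := L * Real.sqrt n with hr
  have hr0 : 0 < r := by positivity
  have hr2 : r ^ 2 = L ^ 2 * n := by rw [hr, mul_pow, Real.sq_sqrt hn'.le]
  set S : Finset (Fin n → ℤ) :=
    (Fintype.piFinset fun _ => Finset.Icc (-((L * n : ℕ) : ℤ)) (L * n : ℕ)).filter fun z =>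
      ∑ i, (z i).natAbs ≤ L * n ∧ ∑ i, (z i : ℝ) ^ 2 ≤ r ^ 2 with hS
  refine ⟨S.image fun z i => z i / r, ?_, ?_, ?_⟩
  · have h := card_le_of_sum_natAbs_le (L * n) S fun z hz => (Finset.mem_filter.1 hz).2.1
    refine (Nat.cast_le.2 Finset.card_image_le).trans (h.trans (le_of_eq ?_))
    rw [mul_pow, pow_mul, mul_comm]
  · intro v hv
    obtain ⟨z, hz, rfl⟩ := Finset.mem_image.1 hv
    have h := (Finset.mem_filter.1 hz).2.2
    simp only [dotProduct, ← sq, div_pow, ← Finset.sum_div]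
    rw [div_le_one (by positivity)]
    exact h
  · intro u hu
    choose z hz1 hz2 using fun i => exists_int_abs_le_abs (r * u i)
    have hsq : ∑ i, (z i : ℝ) ^ 2 ≤ r ^ 2 := by
      calc ∑ i, (z i : ℝ) ^ 2 ≤ ∑ i, (r * u i) ^ 2 :=
            Finset.sum_le_sum fun i _ => sq_le_sq.2 (hz1 i)
        _ = r ^ 2 * (u ⬝ᵥ u) := by
            simp only [mul_pow, ← Finset.mul_sum, dotProduct, ← sq]
        _ ≤ r ^ 2 := by nlinarith [sq_nonneg r]
    have hl1 : ∑ i, (z i).natAbs ≤ L * n := by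
      have h := sq_sum_le_card_mul_sum_sq (s := Finset.univ) (f := fun i => |(z i : ℝ)|)
      simp only [sq_abs, Finset.card_univ, Fintype.card_fin] at h
      have h2 : (∑ i, |(z i : ℝ)|) ^ 2 ≤ (L * n : ℝ) ^ 2 := by
        calc _ ≤ (n : ℝ) * ∑ i, (z i : ℝ) ^ 2 := h
          _ ≤ n * r ^ 2 := by gcongr
          _ = (L * n : ℝ) ^ 2 := by rw [hr2]; ring
      have h3 := abs_le_of_sq_le_sq' h2 (by positivity) |>.2
      have h4 : ((∑ i, (z i).natAbs : ℕ) : ℝ) = ∑ i, |(z i : ℝ)| := by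
        push_cast
        exact Finset.sum_congr rfl fun i _ => by rw [Nat.cast_natAbs, Int.cast_abs]
      rw [← h4] at h3
      exact_mod_cast h3
    refine ⟨fun i => z i / r, Finset.mem_image.2 ⟨z, ?_, rfl⟩, ?_⟩
    · refine Finset.mem_filter.2 ⟨Fintype.mem_piFinset.2 fun i => ?_, hl1, hsq⟩
      have h := (Finset.single_le_sum (f := fun i => (z i).natAbs) (fun i _ => Nat.zero_le _)
        (Finset.mem_univ i)).trans hl1
      rw [Finset.mem_Icc]
      omega
    · simp only [dotProduct, Pi.sub_apply, ← sq]
      calc ∑ i, ((z i : ℝ) / r - u i) ^ 2 ≤ ∑ _i : Fin n, 1 / r ^ 2 := by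
            refine Finset.sum_le_sum fun i _ => ?_
            have : (z i : ℝ) / r - u i = (z i - r * u i) / r := by field_simp
            rw [this, div_pow]
            gcongr
            rw [← sq_abs]
            nlinarith [hz2 i, abs_nonneg ((z i : ℝ) - r * u i)]
        _ = (1 / L : ℝ) ^ 2 := by
            rw [Finset.sum_const, Finset.card_univ, Fintype.card_fin, nsmul_eq_mul, hr2]
            field_simp

/-! ### Products of Bernoulli weights -/

/-- The probability of `y` under independent Bernoulli variables with success probabilities `q`. -/
def bernoulliWeight {ι : Type*} [Fintype ι] (q : ι → ℝ) (y : ι → Bool) : ℝ :=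
  ∏ p, if y p = true then q p else 1 - q p

/-- The value of a Boolean as a real number, `true` being `1`. -/
def boolVal (b : Bool) : ℝ := if b = true then 1 else 0

lemma exp_le_add_exp_sq (x : ℝ) : Real.exp x ≤ x + Real.exp (x ^ 2) := by
  have h1 := Real.add_one_le_exp (x ^ 2)
  rcases le_or_gt |x| 1 with hx | hx
  · have := (abs_le.1 (Real.abs_exp_sub_one_sub_id_le hx)).2
    linarith
  · rcases le_total 0 x with h0 | h0
    · rw [abs_of_nonneg h0] at hx
      have : Real.exp x ≤ Real.exp (x ^ 2) := Real.exp_le_exp.2 (by nlinarith)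
      linarith
    · rw [abs_of_nonpos h0] at hx
      have : Real.exp x ≤ 1 := Real.exp_le_one_iff.2 h0
      nlinarith

lemma bernoulli_mgf_le {q : ℝ} (h0 : 0 ≤ q) (h1 : q ≤ 1) (t : ℝ) :
    q * Real.exp (t * (1 - q)) + (1 - q) * Real.exp (t * (0 - q)) ≤ Real.exp (t ^ 2) := by
  have e1 := exp_le_add_exp_sq (t * (1 - q))
  have e2 := exp_le_add_exp_sq (t * (0 - q))
  have e3 : Real.exp ((t * (1 - q)) ^ 2) ≤ Real.exp (t ^ 2) := by
    apply Real.exp_le_exp.2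
    rw [mul_pow]
    exact mul_le_of_le_one_right (sq_nonneg t) (by nlinarith)
  have e4 : Real.exp ((t * (0 - q)) ^ 2) ≤ Real.exp (t ^ 2) := by
    apply Real.exp_le_exp.2
    rw [mul_pow]
    exact mul_le_of_le_one_right (sq_nonneg t) (by nlinarith)
  have f1 := mul_le_mul_of_nonneg_left (e1.trans (add_le_add_right e3 _)) h0
  have f2 := mul_le_mul_of_nonneg_left (e2.trans (add_le_add_right e4 _)) (sub_nonneg.2 h1)
  nlinarith

section

variable {ι : Type*} [Fintype ι]

lemma bernoulliWeight_nonneg {q : ι → ℝ} (h0 : ∀ p, 0 ≤ q p) (h1 : ∀ p, q p ≤ 1)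
    (y : ι → Bool) : 0 ≤ bernoulliWeight q y := by
  refine Finset.prod_nonneg fun p _ => ?_
  split_ifs
  exacts [h0 p, sub_nonneg.2 (h1 p)]

lemma bernoulliWeight_pos {q : ι → ℝ} (h0 : ∀ p, 0 < q p) (h1 : ∀ p, q p < 1)
    (y : ι → Bool) : 0 < bernoulliWeight q y := by
  refine Finset.prod_pos fun p _ => ?_
  split_ifs
  exacts [h0 p, sub_pos.2 (h1 p)]

lemma sum_prod_bool [DecidableEq ι] (g : ι → Bool → ℝ) :
    ∑ y : ι → Bool, ∏ p, g p (y p) = ∏ p, (g p true + g p false) := by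
  rw [← Fintype.prod_sum]
  simp

lemma sum_bernoulliWeight [DecidableEq ι] (q : ι → ℝ) : ∑ y, bernoulliWeight q y = 1 := by
  simp only [bernoulliWeight]
  rw [sum_prod_bool fun p b => if b = true then q p else 1 - q p]
  simp

/-- Hoeffding's inequality in one direction, with the constant that `exp x ≤ x + exp (x ^ 2)`
gives. -/
lemma sum_bernoulliWeight_le_of_le_sum [DecidableEq ι] {q : ι → ℝ} (h0 : ∀ p, 0 ≤ q p)
    (h1 : ∀ p, q p ≤ 1) (c : ι → ℝ) {V s : ℝ} (hV : 0 < V) (hc : ∑ p, c p ^ 2 ≤ V) (hs : 0 ≤ s)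
    (T : Finset (ι → Bool)) (hT : ∀ y ∈ T, s ≤ ∑ p, c p * (boolVal (y p) - q p)) :
    ∑ y ∈ T, bernoulliWeight q y ≤ Real.exp (-(s ^ 2 / (4 * V))) := by
  -- the Chernoff parameter that minimises `-l * s + l ^ 2 * V`
  set l := s / (2 * V) with hl
  have hl0 : 0 ≤ l := by positivity
  calc ∑ y ∈ T, bernoulliWeight q y
      ≤ ∑ y ∈ T, bernoulliWeight q y *
          (Real.exp (-(l * s)) * Real.exp (l * ∑ p, c p * (boolVal (y p) - q p))) := by
        refine Finset.sum_le_sum fun y hy => ?_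
        refine le_mul_of_one_le_right (bernoulliWeight_nonneg h0 h1 y) ?_
        rw [← Real.exp_add]
        exact Real.one_le_exp (by nlinarith [hT y hy])
    _ ≤ ∑ y, bernoulliWeight q y *
          (Real.exp (-(l * s)) * Real.exp (l * ∑ p, c p * (boolVal (y p) - q p))) :=
        Finset.sum_le_sum_of_subset_of_nonneg (Finset.subset_univ _) fun y _ _ =>
          mul_nonneg (bernoulliWeight_nonneg h0 h1 y) (by positivity)
    _ = Real.exp (-(l * s)) * ∑ y : ι → Bool, ∏ p, (if y p = true then q p else 1 - q p) *
          Real.exp (l * c p * (boolVal (y p) - q p)) := by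
        rw [Finset.mul_sum]
        refine Finset.sum_congr rfl fun y _ => ?_
        rw [Finset.prod_mul_distrib, ← Real.exp_sum, bernoulliWeight, Finset.mul_sum]
        simp only [mul_assoc]
        ring
    _ = Real.exp (-(l * s)) * ∏ p, (q p * Real.exp (l * c p * (1 - q p)) +
          (1 - q p) * Real.exp (l * c p * (0 - q p))) := by
        rw [sum_prod_bool fun p b => (if b = true then q p else 1 - q p) *
          Real.exp (l * c p * (boolVal b - q p))]
        simp [boolVal]
    _ ≤ Real.exp (-(l * s)) * ∏ p, Real.exp ((l * c p) ^ 2) := by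
        gcongr with p
        · intro p _
          have := h0 p
          have := sub_nonneg.2 (h1 p)
          positivity
        · exact bernoulli_mgf_le (h0 p) (h1 p) _
    _ = Real.exp (-(l * s) + l ^ 2 * ∑ p, c p ^ 2) := by
        rw [← Real.exp_sum, ← Real.exp_add, Finset.mul_sum]
        simp only [mul_pow]
    _ ≤ Real.exp (-(s ^ 2 / (4 * V))) := by
        apply Real.exp_le_exp.2
        have : l ^ 2 * ∑ p, c p ^ 2 ≤ l ^ 2 * V := by gcongr
        have e : -(s ^ 2 / (4 * V)) = -(l * s) + l ^ 2 * V := by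
          rw [hl]; field_simp; ring
        linarith

lemma sum_bernoulliWeight_le_of_le_abs [DecidableEq ι] {q : ι → ℝ} (h0 : ∀ p, 0 ≤ q p)
    (h1 : ∀ p, q p ≤ 1) (c : ι → ℝ) {V s : ℝ} (hV : 0 < V) (hc : ∑ p, c p ^ 2 ≤ V) (hs : 0 ≤ s)
    (T : Finset (ι → Bool)) (hT : ∀ y ∈ T, s ≤ |∑ p, c p * (boolVal (y p) - q p)|) :
    ∑ y ∈ T, bernoulliWeight q y ≤ 2 * Real.exp (-(s ^ 2 / (4 * V))) := by
  have e1 := sum_bernoulliWeight_le_of_le_sum h0 h1 c hV hc hs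
    (T.filter fun y => s ≤ ∑ p, c p * (boolVal (y p) - q p)) fun y hy => (Finset.mem_filter.1 hy).2
  have e2 := sum_bernoulliWeight_le_of_le_sum h0 h1 (fun p => -c p) hV (by simpa using hc) hs
    (T.filter fun y => ¬ s ≤ ∑ p, c p * (boolVal (y p) - q p)) fun y hy => by
      obtain ⟨hy1, hy2⟩ := Finset.mem_filter.1 hy
      rcases le_abs'.1 (hT y hy1) with h | h
      · simp only [neg_mul, Finset.sum_neg_distrib]; linarith
      · exact absurd h hy2
  rw [← Finset.sum_filter_add_sum_filter_not T fun y => s ≤ ∑ p, c p * (boolVal (y p) - q p)]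
  linarith

/-- The second moment of the likelihood ratio of two products of Bernoulli laws (one plus their
`χ²` divergence). -/
lemma sum_bernoulliWeight_sq_div_le [DecidableEq ι] {q r : ι → ℝ} {κ : ℝ}
    (h : ∀ p, 0 < r p ∧ r p < 1 ∧ (q p - r p) ^ 2 ≤ κ * (r p * (1 - r p))) :
    ∑ y, bernoulliWeight q y * (bernoulliWeight q y / bernoulliWeight r y)
      ≤ Real.exp (Fintype.card ι * κ) := by
  have e1 : ∀ y : ι → Bool, bernoulliWeight q y * (bernoulliWeight q y / bernoulliWeight r y)
      = ∏ p, (if y p = true then q p ^ 2 / r p else (1 - q p) ^ 2 / (1 - r p)) := by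
    intro y
    rw [bernoulliWeight, bernoulliWeight, ← Finset.prod_div_distrib, ← Finset.prod_mul_distrib]
    refine Finset.prod_congr rfl fun p _ => ?_
    split_ifs <;> ring
  simp only [e1]
  rw [sum_prod_bool fun p b => if b = true then q p ^ 2 / r p else (1 - q p) ^ 2 / (1 - r p)]
  calc _ ≤ ∏ _p : ι, Real.exp κ := by
        refine Finset.prod_le_prod (fun p _ => ?_) fun p _ => ?_
        · have := (h p).1
          have := sub_pos.2 (h p).2.1
          simp only [if_true, Bool.false_eq_true, if_false]
          positivity
        · obtain ⟨hr0, hr1, hqr⟩ := h p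
          have hr1' := sub_pos.2 hr1
          simp only [if_true, Bool.false_eq_true, if_false]
          have e : q p ^ 2 / r p + (1 - q p) ^ 2 / (1 - r p)
              = 1 + (q p - r p) ^ 2 / (r p * (1 - r p)) := by
            field_simp; ring
          rw [e]
          have : (q p - r p) ^ 2 / (r p * (1 - r p)) ≤ κ := by
            rwa [div_le_iff₀ (by positivity)]
          linarith [Real.add_one_le_exp κ]
    _ = Real.exp (Fintype.card ι * κ) := by
        rw [Finset.prod_const, Finset.card_univ, Real.exp_nat_mul]

end

/-! ### The random dot product graph as a product of Bernoulli laws -/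

/-- The pairs `(i, j)` with `i ≤ j`, which index the independent entries of the adjacency matrix. -/
abbrev UpperPair (n : ℕ) : Type := {p : Fin n × Fin n // p.1 ≤ p.2}

/-- The edge probabilities `xᵢᵀ xⱼ`, `i ≤ j`. -/
def edgeProb {n d : ℕ} (X : Fin n → EuclideanSpace ℝ (Fin d)) (p : UpperPair n) : ℝ :=
  inner ℝ (X p.1.1) (X p.1.2)

/-- The entries `y i j`, `i ≤ j`, of a matrix. -/
def upperEntries {n : ℕ} (Y : Matrix (Fin n) (Fin n) Bool) (p : UpperPair n) : Bool := Y p.1.1 p.1.2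

lemma likelihoodRatio_eq {n d : ℕ} (X₀ X : Fin n → EuclideanSpace ℝ (Fin d))
    (Y : Matrix (Fin n) (Fin n) Bool) :
    likelihoodRatio X₀ X Y = bernoulliWeight (edgeProb X) (upperEntries Y) /
      bernoulliWeight (edgeProb X₀) (upperEntries Y) := by
  rw [bernoulliWeight, bernoulliWeight, ← Finset.prod_div_distrib]
  rfl

/-- The expectation over a random dot product graph is a finite sum over the entries on and above
the diagonal. -/
lemma IsRDPG.lintegral_upperEntries {Ω : Type*} [MeasurableSpace Ω] {P : Measure Ω}
    [IsProbabilityMeasure P] {n d : ℕ} {X : Fin n → EuclideanSpace ℝ (Fin d)}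
    {Y : Ω → Matrix (Fin n) (Fin n) Bool} (h : IsRDPG P X Y)
    (h0 : ∀ p, 0 ≤ edgeProb X p) (h1 : ∀ p, edgeProb X p ≤ 1) (F : (UpperPair n → Bool) → ℝ≥0∞) :
    ∫⁻ ω, F (upperEntries (Y ω)) ∂P
      = ∑ y, ENNReal.ofReal (bernoulliWeight (edgeProb X) y) * F y := by
  have hmeas : Measurable fun ω => upperEntries (Y ω) :=
    measurable_pi_lambda _ fun p => h.measurable _ _
  have htrue : ∀ p : UpperPair n, P ((fun ω => Y ω p.1.1 p.1.2) ⁻¹' {true})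
      = ENNReal.ofReal (edgeProb X p) := fun p => h.bernoulli _ _ p.2
  have hfalse : ∀ p : UpperPair n, P ((fun ω => Y ω p.1.1 p.1.2) ⁻¹' {false})
      = ENNReal.ofReal (1 - edgeProb X p) := by
    intro p
    have hc : (fun ω => Y ω p.1.1 p.1.2) ⁻¹' {false}
        = ((fun ω => Y ω p.1.1 p.1.2) ⁻¹' {true})ᶜ := by ext; simp
    rw [hc, prob_compl_eq_one_sub (h.measurable _ _ (measurableSet_singleton _)), htrue,
      ENNReal.ofReal_sub _ (h0 p), ENNReal.ofReal_one]
  have hP : ∀ y : UpperPair n → Bool, P ((fun ω => upperEntries (Y ω)) ⁻¹' {y})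
      = ENNReal.ofReal (bernoulliWeight (edgeProb X) y) := by
    intro y
    have h2 := h.indep.measure_inter_preimage_eq_mul Finset.univ (sets := fun p => {y p})
      fun p _ => measurableSet_singleton _
    have hset : (fun ω => upperEntries (Y ω)) ⁻¹' {y}
        = ⋂ p ∈ (Finset.univ : Finset (UpperPair n)), (fun ω => Y ω p.1.1 p.1.2) ⁻¹' {y p} := by
      ext ω
      simp [funext_iff, upperEntries]
    rw [hset, h2, bernoulliWeight, ENNReal.ofReal_prod_of_nonneg]
    · refine Finset.prod_congr rfl fun p _ => ?_
      cases y p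
      · simpa using hfalse p
      · simpa using htrue p
    · intro p _
      split_ifs
      exacts [h0 p, sub_nonneg.2 (h1 p)]
  rw [← lintegral_map (measurable_of_finite F) hmeas, lintegral_fintype]
  refine Finset.sum_congr rfl fun y _ => ?_
  rw [Measure.map_apply hmeas (measurableSet_singleton _), hP, mul_comm]

lemma edgeProb_mem_of_latent {n d : ℕ} {X : Fin n → EuclideanSpace ℝ (Fin d)}
    (hX : X ∈ latentFamilies n d) (p : UpperPair n) : 0 ≤ edgeProb X p ∧ edgeProb X p ≤ 1 := by
  refine ⟨?_, ?_⟩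
  · rw [edgeProb, PiLp.inner_apply]
    exact Finset.sum_nonneg fun k _ => mul_nonneg ((hX _).2 k) ((hX _).2 k)
  · refine (real_inner_le_norm _ _).trans ?_
    exact mul_le_one₀ (hX _).1 (norm_nonneg _) (hX _).1

/-! ### Testing by quadratic forms -/

/-- The difference `X Xᵀ - X₀ X₀ᵀ` of the matrices of edge probabilities. -/
def gramDiff {n d : ℕ} (X X₀ : Fin n → EuclideanSpace ℝ (Fin d)) : Matrix (Fin n) (Fin n) ℝ :=
  latentMatrix X * (latentMatrix X)ᵀ - latentMatrix X₀ * (latentMatrix X₀)ᵀ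

lemma latentMatrix_mul_transpose_apply {n d : ℕ} (X : Fin n → EuclideanSpace ℝ (Fin d))
    (i j : Fin n) : (latentMatrix X * (latentMatrix X)ᵀ) i j = inner ℝ (X i) (X j) := by
  simp [Matrix.mul_apply, latentMatrix, PiLp.inner_apply, mul_comm]

lemma gramDiff_apply {n d : ℕ} (X X₀ : Fin n → EuclideanSpace ℝ (Fin d)) (p : UpperPair n) :
    gramDiff X X₀ p.1.1 p.1.2 = edgeProb X p - edgeProb X₀ p := by
  rw [gramDiff, Matrix.sub_apply, latentMatrix_mul_transpose_apply,
    latentMatrix_mul_transpose_apply]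
  rfl

lemma gramDiff_isHermitian {n d : ℕ} (X X₀ : Fin n → EuclideanSpace ℝ (Fin d)) :
    (gramDiff X X₀).IsHermitian := by
  refine Matrix.IsHermitian.ext fun i j => ?_
  simp only [gramDiff, Matrix.sub_apply, latentMatrix_mul_transpose_apply, star_trivial,
    real_inner_comm]

/-- The coefficients of the quadratic form `A ↦ vᵀ A v` of a symmetric matrix in its entries on and
above the diagonal. -/
def quadCoeff {n : ℕ} (v : Fin n → ℝ) (p : UpperPair n) : ℝ :=
  (if p.1.1 = p.1.2 then 1 else 2) * (v p.1.1 * v p.1.2)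

lemma sum_upperPair {n : ℕ} (g : Fin n → Fin n → ℝ) (hg : ∀ i j, g i j = g j i) :
    ∑ i, ∑ j, g i j = ∑ p : UpperPair n, (if p.1.1 = p.1.2 then 1 else 2) * g p.1.1 p.1.2 := by
  have e1 : ∑ p : UpperPair n, (if p.1.1 = p.1.2 then 1 else 2) * g p.1.1 p.1.2
      = ∑ p : Fin n × Fin n with p.1 ≤ p.2, (if p.1 = p.2 then 1 else 2) * g p.1 p.2 :=
    (Finset.sum_subtype (p := fun p : Fin n × Fin n => p.1 ≤ p.2)
      (Finset.univ.filter fun p : Fin n × Fin n => p.1 ≤ p.2) (by simp)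
      fun p => (if p.1 = p.2 then 1 else 2) * g p.1 p.2).symm
  rw [e1, Finset.sum_filter, Fintype.sum_prod_type]
  have e2 : ∑ i, ∑ j, (if i ≤ j then (if i = j then 1 else 2) * g i j else 0)
      = ∑ i, ∑ j, ((if i ≤ j then g i j else 0) + if i < j then g i j else 0) := by
    refine Finset.sum_congr rfl fun i _ => Finset.sum_congr rfl fun j _ => ?_
    rcases lt_trichotomy i j with h | h | h
    · simp [h, h.le, h.ne]; ring
    · simp [h]
    · simp [h.not_ge, h.not_gt]
  have e3 : ∑ i, ∑ j, (if i < j then g i j else 0) = ∑ i, ∑ j, (if j < i then g i j else 0) := by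
    rw [Finset.sum_comm]
    exact Finset.sum_congr rfl fun i _ => Finset.sum_congr rfl fun j _ => by rw [hg]
  rw [e2]
  simp only [Finset.sum_add_distrib]
  rw [e3]
  simp only [← Finset.sum_add_distrib]
  refine Finset.sum_congr rfl fun i _ => Finset.sum_congr rfl fun j _ => ?_
  rcases le_or_gt i j with h | h
  · simp [h, h.not_gt]
  · simp [h, h.not_ge]

lemma sum_quadCoeff_mul {n : ℕ} (v : Fin n → ℝ) {D : Matrix (Fin n) (Fin n) ℝ}
    (hD : D.IsHermitian) : ∑ p, quadCoeff v p * D p.1.1 p.1.2 = v ⬝ᵥ D *ᵥ v := by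
  have hD' : ∀ i j, D i j = D j i := fun i j => by simpa using (hD.apply i j).symm
  have h := sum_upperPair (fun i j => v i * v j * D i j) fun i j => by rw [hD' i j]; ring
  simp only [quadCoeff, dotProduct, Matrix.mulVec, Finset.mul_sum, mul_assoc] at h ⊢
  rw [← h]
  exact Finset.sum_congr rfl fun i _ => Finset.sum_congr rfl fun j _ => by ring

lemma sum_quadCoeff_sq_le {n : ℕ} {v : Fin n → ℝ} (hv : v ⬝ᵥ v ≤ 1) :
    ∑ p, quadCoeff v p ^ 2 ≤ 2 := by
  have h := sum_upperPair (fun i j => (v i * v j) ^ 2) fun i j => by ring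
  have h2 : ∑ i, ∑ j, (v i * v j) ^ 2 = (v ⬝ᵥ v) ^ 2 := by
    rw [sq, dotProduct, Finset.sum_mul_sum]
    exact Finset.sum_congr rfl fun i _ => Finset.sum_congr rfl fun j _ => by ring
  have h0 : 0 ≤ v ⬝ᵥ v := Finset.sum_nonneg fun i _ => mul_self_nonneg _
  calc ∑ p, quadCoeff v p ^ 2
      ≤ ∑ p : UpperPair n, 2 * ((if p.1.1 = p.1.2 then 1 else 2) * (v p.1.1 * v p.1.2) ^ 2) := by
        refine Finset.sum_le_sum fun p _ => ?_
        rw [quadCoeff]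
        have := sq_nonneg (v p.1.1 * v p.1.2)
        split_ifs <;> nlinarith
    _ = 2 * (v ⬝ᵥ v) ^ 2 := by rw [← Finset.mul_sum, ← h, h2]
    _ ≤ 2 := by nlinarith

/-- The quadratic form of `Y - X₀ X₀ᵀ` at `v`, in terms of the entries of `Y` on and above the
diagonal. -/
def noiseForm {n d : ℕ} (X₀ : Fin n → EuclideanSpace ℝ (Fin d)) (v : Fin n → ℝ)
    (y : UpperPair n → Bool) : ℝ :=
  ∑ p, quadCoeff v p * (boolVal (y p) - edgeProb X₀ p)

lemma noiseForm_eq_add {n d : ℕ} (X X₀ : Fin n → EuclideanSpace ℝ (Fin d)) (v : Fin n → ℝ)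
    (y : UpperPair n → Bool) :
    noiseForm X₀ v y = noiseForm X v y + v ⬝ᵥ gramDiff X X₀ *ᵥ v := by
  rw [← sum_quadCoeff_mul v (gramDiff_isHermitian X X₀), noiseForm, noiseForm,
    ← Finset.sum_add_distrib]
  refine Finset.sum_congr rfl fun p _ => ?_
  rw [gramDiff_apply]
  ring

open Classical in
/-- The outcomes rejected by the test of `X₀`: some quadratic form of `Y - X₀ X₀ᵀ` at a point of the
net `N` is at least `s`. -/
def rejectSet {n d : ℕ} (X₀ : Fin n → EuclideanSpace ℝ (Fin d)) (N : Finset (Fin n → ℝ)) (s : ℝ) :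
    Finset (UpperPair n → Bool) :=
  Finset.univ.filter fun y => ∃ v ∈ N, s ≤ |noiseForm X₀ v y|

lemma sum_rejectSet_le {n d : ℕ} {X₀ : Fin n → EuclideanSpace ℝ (Fin d)}
    (hX₀ : X₀ ∈ latentFamilies n d) {N : Finset (Fin n → ℝ)} (hN : ∀ v ∈ N, v ⬝ᵥ v ≤ 1) {s : ℝ}
    (hs : 0 ≤ s) :
    ∑ y ∈ rejectSet X₀ N s, bernoulliWeight (edgeProb X₀) y
      ≤ N.card * (2 * Real.exp (-(s ^ 2 / 8))) := by
  classical
  have hq := edgeProb_mem_of_latent hX₀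
  have hw := bernoulliWeight_nonneg (fun p => (hq p).1) (fun p => (hq p).2)
  calc ∑ y ∈ rejectSet X₀ N s, bernoulliWeight (edgeProb X₀) y
      ≤ ∑ y ∈ rejectSet X₀ N s, ∑ v ∈ N,
          (if s ≤ |noiseForm X₀ v y| then bernoulliWeight (edgeProb X₀) y else 0) := by
        refine Finset.sum_le_sum fun y hy => ?_
        obtain ⟨v, hv, h⟩ := (Finset.mem_filter.1 hy).2
        refine le_trans (le_of_eq (if_pos h).symm) (Finset.single_le_sum
          (f := fun v => if s ≤ |noiseForm X₀ v y| then bernoulliWeight (edgeProb X₀) y else 0)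
          (fun v _ => ?_) hv)
        split_ifs
        exacts [hw y, le_rfl]
    _ ≤ ∑ y, ∑ v ∈ N,
          (if s ≤ |noiseForm X₀ v y| then bernoulliWeight (edgeProb X₀) y else 0) := by
        refine Finset.sum_le_sum_of_subset_of_nonneg (Finset.subset_univ _) fun y _ _ =>
          Finset.sum_nonneg fun v _ => ?_
        split_ifs
        exacts [hw y, le_rfl]
    _ = ∑ v ∈ N, ∑ y with s ≤ |noiseForm X₀ v y|, bernoulliWeight (edgeProb X₀) y := by
        rw [Finset.sum_comm]
        simp only [Finset.sum_filter]
    _ ≤ ∑ v ∈ N, 2 * Real.exp (-(s ^ 2 / 8)) := by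
        refine Finset.sum_le_sum fun v hv => ?_
        have h := sum_bernoulliWeight_le_of_le_abs (fun p => (hq p).1) (fun p => (hq p).2)
          (quadCoeff v) two_pos (sum_quadCoeff_sq_le (hN v hv)) hs
          (Finset.univ.filter fun y => s ≤ |noiseForm X₀ v y|)
          fun y hy => (Finset.mem_filter.1 hy).2
        norm_num at h ⊢
        exact h
    _ = _ := by rw [Finset.sum_const, nsmul_eq_mul]

/-- The error of the second kind: at a distance from `X₀` that exceeds the critical value, a single
point of the net already detects the alternative. -/
lemma sum_compl_rejectSet_le {n d : ℕ} (hd : 1 ≤ d) {X X₀ : Fin n → EuclideanSpace ℝ (Fin d)}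
    (hX : X ∈ latentFamilies n d) {N : Finset (Fin n → ℝ)} (hN : ∀ v ∈ N, v ⬝ᵥ v ≤ 1)
    (hnet : ∀ u : Fin n → ℝ, u ⬝ᵥ u ≤ 1 →
      ∃ v ∈ N, (v - u) ⬝ᵥ (v - u) ≤ (1 / (8 * d : ℕ) : ℝ) ^ 2) {s : ℝ} (hs : 0 ≤ s)
    (hfar : 16 * d * s < frobNorm (gramDiff X X₀)) :
    ∑ y ∈ (rejectSet X₀ N s)ᶜ, bernoulliWeight (edgeProb X) y
      ≤ 2 * Real.exp (-(frobNorm (gramDiff X X₀) ^ 2 / (2048 * d ^ 2))) := by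
  classical
  have hd' : (1 : ℝ) ≤ d := by exact_mod_cast hd
  have hD0 : gramDiff X X₀ ≠ 0 := by
    intro h
    have h2 : frobNorm (gramDiff X X₀) ^ 2 = 0 := by rw [frobNorm_sq_eq_sum, h]; simp
    have h3 : 0 < frobNorm (gramDiff X X₀) := lt_of_le_of_lt (by positivity) hfar
    nlinarith
  obtain ⟨u, hu, hunear⟩ := exists_unit_forall_near_frobNorm_le (gramDiff_isHermitian X X₀)
    (r := 2 * d) (by omega) (rank_mul_transpose_sub_le _ _) hD0
  obtain ⟨v, hv, hvu⟩ := hnet u hu.le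
  have hq := edgeProb_mem_of_latent hX
  have h1 := hunear v (by
    refine hvu.trans (le_of_eq ?_)
    push_cast; ring)
  push_cast at h1
  set F := frobNorm (gramDiff X X₀) with hF
  have h := sum_bernoulliWeight_le_of_le_abs (fun p => (hq p).1) (fun p => (hq p).2)
    (quadCoeff v) two_pos (sum_quadCoeff_sq_le (hN v hv)) (s := F / (16 * d))
    (div_nonneg (frobNorm_nonneg _) (by positivity)) (rejectSet X₀ N s)ᶜ (by
      intro y hy
      have hy' : ¬ ∃ v ∈ N, s ≤ |noiseForm X₀ v y| := by
        simpa [rejectSet] using hy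
      push Not at hy'
      have h2 := hy' v hv
      rw [noiseForm_eq_add X X₀] at h2
      change F / (16 * d) ≤ |noiseForm X v y|
      have h3 : F / (8 * d) ≤ |v ⬝ᵥ gramDiff X X₀ *ᵥ v| := by
        rw [div_le_iff₀ (by positivity)]; linarith
      have h4 : s < F / (16 * d) := by
        rw [lt_div_iff₀ (by positivity)]; linarith
      have h5 : F / (8 * d) = F / (16 * d) + F / (16 * d) := by field_simp; ring
      have h6 := abs_sub (noiseForm X v y + v ⬝ᵥ gramDiff X X₀ *ᵥ v) (noiseForm X v y)
      rw [add_sub_cancel_left] at h6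
      linarith)
  refine h.trans (le_of_eq ?_)
  congr 2
  field_simp
  ring

/-! ### Posterior mass and tests -/

section

variable {Θ 𝒴 : Type*} [MeasurableSpace Θ]

lemma sq_measure_univ_le_lintegral_mul_lintegral_inv (ν : Measure Θ) {g : Θ → ℝ≥0∞}
    (hg : Measurable g) (h : ∀ᵐ θ ∂ν, g θ ≠ 0 ∧ g θ ≠ ⊤) :
    ν Set.univ ^ 2 ≤ (∫⁻ θ, g θ ∂ν) * ∫⁻ θ, (g θ)⁻¹ ∂ν := by
  have h1 := ENNReal.lintegral_mul_le_Lp_mul_Lq ν Real.HolderConjugate.two_two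
    (f := fun θ => g θ ^ (1 / 2 : ℝ)) (g := fun θ => (g θ)⁻¹ ^ (1 / 2 : ℝ))
    (by fun_prop) (by fun_prop)
  have e1 : ∫⁻ θ, ((fun θ => g θ ^ (1 / 2 : ℝ)) * fun θ => (g θ)⁻¹ ^ (1 / 2 : ℝ)) θ ∂ν
      = ν Set.univ := by
    rw [← lintegral_one]
    refine lintegral_congr_ae ?_
    filter_upwards [h] with θ hθ
    simp only [Pi.mul_apply]
    rw [← ENNReal.mul_rpow_of_nonneg _ _ (by norm_num), ENNReal.mul_inv_cancel hθ.1 hθ.2,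
      ENNReal.one_rpow]
  have e2 : ∀ x : ℝ≥0∞, (x ^ (1 / 2 : ℝ)) ^ (2 : ℝ) = x := by
    intro x
    rw [← ENNReal.rpow_mul]
    norm_num
  rw [e1] at h1
  simp only [e2] at h1
  rw [← ENNReal.mul_rpow_of_nonneg _ _ (by norm_num)] at h1
  calc ν Set.univ ^ 2 = ν Set.univ ^ (2 : ℝ) := by norm_cast
    _ ≤ _ := by
      refine (ENNReal.rpow_le_rpow h1 (by norm_num)).trans ?_
      rw [e2]

/-- A bound for the expected posterior mass of `A`. Off the rejection set `T` of a test, the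
numerator is controlled by the error of the second kind, and the denominator is at least `τ` unless
an event of small probability occurs. The probability of that event is bounded by the Markov
inequality for the reciprocal of the denominator, which the Cauchy-Schwarz inequality reduces to the
second moments `χ` of the likelihood ratios on `B`. -/
lemma sum_mul_posterior_le [Fintype 𝒴] [DecidableEq 𝒴] (ν : Measure Θ) (w₀ : 𝒴 → ℝ≥0∞)
    (w : Θ → 𝒴 → ℝ≥0∞)
    (hw : ∀ y, Measurable fun θ => w θ y) (hw₀ : ∀ y, w₀ y ≠ 0 ∧ w₀ y ≠ ⊤) {A B S : Set Θ}
    (hAS : A ⊆ S) (hBS : B ⊆ S) (hB : MeasurableSet B) (T : Finset 𝒴) {τ χ : ℝ≥0∞} (hτ : τ ≠ 0)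
    (hτ' : τ ≠ ⊤) (hνB : ν B ≠ 0) (hνB' : ν B ≠ ⊤) (hwB : ∀ θ ∈ B, ∀ y, w θ y ≠ 0 ∧ w θ y ≠ ⊤)
    (hχ : ∀ θ ∈ B, ∑ y, w₀ y * (w₀ y / w θ y) ≤ χ) :
    ∑ y, w₀ y * ((∫⁻ θ in A, w θ y / w₀ y ∂ν) / ∫⁻ θ in S, w θ y / w₀ y ∂ν)
      ≤ ∑ y ∈ T, w₀ y + τ * (χ / ν B) + (∫⁻ θ in A, ∑ y ∈ Tᶜ, w θ y ∂ν) / τ := by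
  have hpoint : ∀ y, w₀ y * ((∫⁻ θ in A, w θ y / w₀ y ∂ν) / ∫⁻ θ in S, w θ y / w₀ y ∂ν)
      ≤ (if y ∈ T then w₀ y else 0) + τ * ((∫⁻ θ in B, w₀ y * (w₀ y / w θ y) ∂ν) / ν B ^ 2)
        + (if y ∈ Tᶜ then ∫⁻ θ in A, w θ y ∂ν else 0) / τ := by
    intro y
    obtain ⟨h0, h1⟩ := hw₀ y
    set a := ∫⁻ θ in A, w θ y / w₀ y ∂ν with ha
    set s := ∫⁻ θ in S, w θ y / w₀ y ∂ν
    set b := ∫⁻ θ in B, w θ y / w₀ y ∂ν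
    have has : a ≤ s := lintegral_mono_set hAS
    have hbs : b ≤ s := lintegral_mono_set hBS
    have hle : w₀ y * (a / s) ≤ w₀ y := by
      refine mul_le_of_le_one_right zero_le ?_
      exact ENNReal.div_le_of_le_mul (by rwa [one_mul])
    by_cases hy : y ∈ T
    · rw [if_pos hy, add_assoc]
      exact hle.trans le_self_add
    rcases lt_or_ge s τ with hs | hs
    · have hcs := sq_measure_univ_le_lintegral_mul_lintegral_inv (ν.restrict B)
        (g := fun θ => w θ y / w₀ y) ((hw y).div_const _) (by
          filter_upwards [ae_restrict_mem hB] with θ hθ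
          exact ⟨ENNReal.div_ne_zero.2 ⟨(hwB θ hθ y).1, h1⟩,
            ENNReal.div_ne_top (hwB θ hθ y).2 h0⟩)
      rw [Measure.restrict_apply_univ] at hcs
      set I := ∫⁻ θ in B, (w θ y / w₀ y)⁻¹ ∂ν with hI
      have hI' : ∫⁻ θ in B, w₀ y * (w₀ y / w θ y) ∂ν = w₀ y * I := by
        rw [hI, ← lintegral_const_mul' _ _ h1]
        refine setLIntegral_congr_fun hB fun θ hθ => ?_
        rw [ENNReal.inv_div (Or.inl h1) (Or.inl h0)]
      have hbI : b⁻¹ ≤ I / ν B ^ 2 := by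
        rw [ENNReal.le_div_iff_mul_le (Or.inl (pow_ne_zero 2 hνB))
          (Or.inl (ENNReal.pow_ne_top hνB'))]
        calc b⁻¹ * ν B ^ 2 ≤ b⁻¹ * (b * I) := by gcongr
          _ = b⁻¹ * b * I := by rw [mul_assoc]
          _ ≤ 1 * I := by gcongr; exact ENNReal.inv_mul_le_one _
          _ = I := one_mul I
      have hτb : 1 ≤ τ * b⁻¹ := by
        rw [← div_eq_mul_inv]
        rw [ENNReal.le_div_iff_mul_le (Or.inr hτ) (Or.inr hτ'), one_mul]
        exact hbs.trans hs.le
      refine hle.trans (le_trans ?_ (le_add_right (le_add_left le_rfl)))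
      calc w₀ y = w₀ y * 1 := (mul_one _).symm
        _ ≤ w₀ y * (τ * (I / ν B ^ 2)) := by gcongr; exact hτb.trans (by gcongr)
        _ = τ * ((∫⁻ θ in B, w₀ y * (w₀ y / w θ y) ∂ν) / ν B ^ 2) := by
          rw [hI', mul_div_assoc]; ring
    · rw [if_pos (Finset.mem_compl.2 hy)]
      refine le_trans ?_ le_add_self
      have hwa : w₀ y * a = ∫⁻ θ in A, w θ y ∂ν := by
        rw [ha, ← lintegral_const_mul' _ _ h1]
        exact lintegral_congr fun θ => ENNReal.mul_div_cancel h0 h1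
      rw [← hwa, mul_div_assoc]
      gcongr
  refine (Finset.sum_le_sum fun y _ => hpoint y).trans ?_
  simp only [Finset.sum_add_distrib]
  refine add_le_add (add_le_add (le_of_eq (by simp)) ?_) (le_of_eq ?_)
  · rw [← Finset.mul_sum]
    gcongr
    simp only [div_eq_mul_inv _ (ν B ^ 2)]
    rw [← Finset.sum_mul, ← lintegral_finsetSum' _ (by
      intro y _
      have := hw y
      fun_prop), ← div_eq_mul_inv]
    refine ENNReal.div_le_of_le_mul ?_
    calc ∫⁻ θ in B, ∑ y, w₀ y * (w₀ y / w θ y) ∂ν ≤ ∫⁻ θ in B, χ ∂ν :=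
          setLIntegral_mono' hB hχ
      _ = χ * ν B := by rw [setLIntegral_const]
      _ = χ / ν B * ν B ^ 2 := by
          rw [sq, ← mul_assoc, ENNReal.div_mul_cancel hνB hνB']
  · simp only [div_eq_mul_inv]
    rw [← Finset.sum_mul, lintegral_finsetSum' _ (fun y _ => (hw y).aemeasurable),
      Finset.sum_ite_mem, Finset.univ_inter]

end

/-! ### Prior masses and Gaussian integrals -/

lemma IsPriorDensity.isProbabilityMeasure {d : ℕ} {f : EuclideanSpace ℝ (Fin d) → ℝ}
    (hf : IsPriorDensity f) :
    IsProbabilityMeasure (volume.withDensity fun x => ENNReal.ofReal (f x)) :=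
  ⟨by rw [withDensity_apply _ MeasurableSet.univ, setLIntegral_univ, hf.lintegral_eq_one]⟩

lemma IsPriorDensity.exists_bounds {d : ℕ} {f : EuclideanSpace ℝ (Fin d) → ℝ}
    (hf : IsPriorDensity f) :
    ∃ a b : ℝ, 0 < a ∧ 0 < b ∧ (∀ x ∈ latentSpace d, a ≤ f x) ∧ ∀ x, f x ≤ b := by
  obtain ⟨a, b, ha, hab⟩ := hf.bounds
  have h0 : (0 : EuclideanSpace ℝ (Fin d)) ∈ latentSpace d := by simp [latentSpace]
  have hb : 0 < b := ha.trans_le ((hab 0 h0).1.trans (hab 0 h0).2)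
  refine ⟨a, b, ha, hb, fun x hx => (hab x hx).1, fun x => ?_⟩
  by_cases hx : x ∈ latentSpace d
  · exact (hab x hx).2
  · rw [hf.eq_zero x hx]; exact hb.le

/-- The cube with lower corner `m` and side `h`. -/
def cornerBox {d : ℕ} (m : EuclideanSpace ℝ (Fin d)) (h : ℝ) : Set (EuclideanSpace ℝ (Fin d)) :=
  {x | ∀ k, x k ∈ Set.Icc (m k) (m k + h)}

lemma measurableSet_cornerBox {d : ℕ} (m : EuclideanSpace ℝ (Fin d)) (h : ℝ) :
    MeasurableSet (cornerBox m h) := by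
  have : cornerBox m h = ⋂ k, (fun x : EuclideanSpace ℝ (Fin d) => x k) ⁻¹'
      Set.Icc (m k) (m k + h) := by
    ext; simp [cornerBox]
  rw [this]
  exact MeasurableSet.iInter fun k => (by fun_prop : Measurable
    fun x : EuclideanSpace ℝ (Fin d) => x k) measurableSet_Icc

lemma volume_cornerBox {d : ℕ} (m : EuclideanSpace ℝ (Fin d)) {h : ℝ} (hh : 0 ≤ h) :
    volume (cornerBox m h) = ENNReal.ofReal (h ^ d) := by
  rw [← (PiLp.volume_preserving_toLp (Fin d)).measure_preimage
    (measurableSet_cornerBox m h).nullMeasurableSet]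
  have : (WithLp.toLp 2) ⁻¹' cornerBox m h = Set.pi Set.univ fun k : Fin d =>
      Set.Icc (m k) (m k + h) := by
    ext; simp [cornerBox, Pi.le_def, forall_and]
  rw [this, volume_pi_pi]
  simp [ENNReal.ofReal_pow hh]

lemma le_withDensity_cornerBox {d : ℕ} {f : EuclideanSpace ℝ (Fin d) → ℝ} {a h : ℝ} (ha : 0 ≤ a)
    (hh : 0 ≤ h) {m : EuclideanSpace ℝ (Fin d)} (hf : ∀ x ∈ cornerBox m h, a ≤ f x) :
    ENNReal.ofReal (a * h ^ d) ≤
      (volume.withDensity fun x => ENNReal.ofReal (f x)) (cornerBox m h) := by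
  rw [withDensity_apply _ (measurableSet_cornerBox m h), ENNReal.ofReal_mul ha,
    ← volume_cornerBox m hh, ← setLIntegral_const]
  exact setLIntegral_mono' (measurableSet_cornerBox m h) fun x hx =>
    ENNReal.ofReal_le_ofReal (hf x hx)

lemma lintegral_gaussian {d : ℕ} {c : ℝ} (hc : 0 < c) (m : EuclideanSpace ℝ (Fin d)) :
    ∫⁻ x, ENNReal.ofReal (Real.exp (-c * ‖x - m‖ ^ 2))
      = ENNReal.ofReal (Real.sqrt (Real.pi / c) ^ d) := by
  have h := GaussianFourier.integral_rexp_neg_mul_sq_norm (V := EuclideanSpace ℝ (Fin d)) hc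
  have hpow : (Real.pi / c) ^ (d / 2 : ℝ) = Real.sqrt (Real.pi / c) ^ d := by
    rw [Real.sqrt_eq_rpow, ← Real.rpow_natCast, ← Real.rpow_mul (by positivity)]
    congr 1
    ring
  rw [finrank_euclideanSpace_fin, hpow] at h
  have hint : Integrable fun x : EuclideanSpace ℝ (Fin d) => Real.exp (-c * ‖x‖ ^ 2) := by
    by_contra hni
    rw [integral_undef hni] at h
    have : 0 < Real.sqrt (Real.pi / c) ^ d := by have := Real.pi_pos; positivity
    linarith
  rw [lintegral_sub_right_eq_self
    (fun x : EuclideanSpace ℝ (Fin d) => ENNReal.ofReal (Real.exp (-c * ‖x‖ ^ 2))) m,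
    ← ofReal_integral_eq_lintegral_ofReal hint (Eventually.of_forall fun x => by positivity), h]

lemma lintegral_withDensity_gaussian_le {d : ℕ} {f : EuclideanSpace ℝ (Fin d) → ℝ}
    (hfm : Measurable f) {b c : ℝ} (hb : 0 ≤ b) (hf : ∀ x, f x ≤ b) (hc : 0 < c)
    (m : EuclideanSpace ℝ (Fin d)) :
    ∫⁻ x, ENNReal.ofReal (Real.exp (-c * ‖x - m‖ ^ 2))
        ∂(volume.withDensity fun x => ENNReal.ofReal (f x))
      ≤ ENNReal.ofReal (b * Real.sqrt (Real.pi / c) ^ d) := by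
  rw [lintegral_withDensity_eq_lintegral_mul _ (by fun_prop) (by fun_prop), ENNReal.ofReal_mul hb,
    ← lintegral_gaussian hc m, ← lintegral_const_mul _ (by fun_prop)]
  refine lintegral_mono fun x => ?_
  simp only [Pi.mul_apply]
  gcongr
  exact hf x

lemma lintegral_pi_prod {n : ℕ} {E : Type*} [MeasurableSpace E] (μ : Measure E)
    [IsProbabilityMeasure μ] (g : Fin n → E → ℝ≥0∞) (hg : ∀ i, Measurable (g i)) :
    ∫⁻ x, ∏ i, g i (x i) ∂(Measure.pi fun _ : Fin n => μ) = ∏ i, ∫⁻ x, g i x ∂μ := by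
  have hind := iIndepFun_pi (μ := fun _ : Fin n => μ) (X := g) fun i => (hg i).aemeasurable
  rw [lintegral_prod_eq_prod_lintegral_of_indepFun Finset.univ
    (fun i (x : Fin n → E) => g i (x i)) hind fun i => (hg i).comp (measurable_pi_apply i)]
  exact Finset.prod_congr rfl fun i _ =>
    (measurePreserving_eval (fun _ : Fin n => μ) i).lintegral_comp (hg i)

/-! ### The prior integral of Gaussian weights in the gram loss -/

lemma gramLoss_eq {n d : ℕ} (X X₀ : Fin n → EuclideanSpace ℝ (Fin d)) :
    gramLoss X X₀ = 1 / n * frobNorm (gramDiff X X₀) := rfl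

lemma gramLoss_le_iff {n d : ℕ} (hn : 1 ≤ n) (X X₀ : Fin n → EuclideanSpace ℝ (Fin d)) (M : ℝ) :
    gramLoss X X₀ ≤ M / Real.sqrt n ↔ frobNorm (gramDiff X X₀) ≤ M * Real.sqrt n := by
  have hn' : (0 : ℝ) < n := by exact_mod_cast hn
  have hs : 0 < Real.sqrt n := Real.sqrt_pos.2 hn'
  have h2 : Real.sqrt n * Real.sqrt n = n := Real.mul_self_sqrt hn'.le
  rw [gramLoss_eq, one_div, inv_mul_le_iff₀ hn']
  have : (n : ℝ) * (M / Real.sqrt n) = M * Real.sqrt n := by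
    rw [mul_div_assoc', div_eq_iff hs.ne', mul_assoc, h2, mul_comm]
  rw [this]

/-- The point of the grid `{-1, …, -1/n, 0, 1/n, …, 1}` of index `k`. -/
def gridPoint (n : ℕ) (k : Fin (2 * n + 1)) : ℝ := ((k : ℝ) - n) / n

lemma exists_gridPoint_near {n : ℕ} (hn : 1 ≤ n) {x : ℝ} (h0 : -1 ≤ x) (h1 : x ≤ 1) :
    ∃ k, |x - gridPoint n k| ≤ 1 / n := by
  have hn' : (0 : ℝ) < n := by exact_mod_cast hn
  have hx : (0 : ℝ) ≤ n * x + n := by nlinarith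
  have hk : ⌊n * x + n⌋₊ < 2 * n + 1 := by
    rw [Nat.lt_succ_iff]
    refine Nat.floor_le_of_le ?_
    push_cast; nlinarith
  refine ⟨⟨_, hk⟩, ?_⟩
  have e : x - gridPoint n ⟨_, hk⟩ = (n * x + n - ⌊n * x + n⌋₊) / n := by
    simp only [gridPoint]; field_simp; ring
  rw [e, abs_div, abs_of_pos hn']
  gcongr
  rw [abs_le]
  constructor <;> linarith [Nat.floor_le hx, Nat.lt_floor_add_one (n * x + n)]

/-- The `d × d` matrix with entries in the grid that has index `g`; such matrices approximate the
orthogonal matrices, but need not be orthogonal. -/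
def gridMatrix {d : ℕ} (n : ℕ) (g : Fin d → Fin d → Fin (2 * n + 1)) : Matrix (Fin d) (Fin d) ℝ :=
  Matrix.of fun i j => gridPoint n (g i j)

lemma frobNorm_sq_sub_eq_sum_norm {n d : ℕ} (X : Fin n → EuclideanSpace ℝ (Fin d))
    (V : Matrix (Fin n) (Fin d) ℝ) :
    frobNorm (latentMatrix X - V) ^ 2 = ∑ i, ‖X i - WithLp.toLp 2 (V i)‖ ^ 2 := by
  rw [frobNorm_sq_eq_sum]
  refine Finset.sum_congr rfl fun i _ => ?_
  rw [EuclideanSpace.norm_sq_eq]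
  simp [latentMatrix]

lemma latent_entry_mem {n d : ℕ} {X : Fin n → EuclideanSpace ℝ (Fin d)}
    (hX : X ∈ latentFamilies n d) (i : Fin n) (k : Fin d) : 0 ≤ X i k ∧ X i k ≤ 1 := by
  refine ⟨(hX i).2 k, ?_⟩
  have h := PiLp.norm_apply_le (X i) k
  exact (le_abs_self _).trans (h.trans (hX i).1)

lemma frobNorm_sq_mul_le {n d : ℕ} (hn : 1 ≤ n) {X₀ : Fin n → EuclideanSpace ℝ (Fin d)}
    (hX₀ : X₀ ∈ latentFamilies n d) {E : Matrix (Fin d) (Fin d) ℝ} (hE : ∀ i j, |E i j| ≤ 1 / n) :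
    frobNorm (latentMatrix X₀ * E) ^ 2 ≤ d ^ 3 / n := by
  have hn' : (0 : ℝ) < n := by exact_mod_cast hn
  have hentry : ∀ i j, (latentMatrix X₀ * E) i j ^ 2 ≤ (d / n : ℝ) ^ 2 := by
    intro i j
    rw [← sq_abs]
    refine pow_le_pow_left₀ (abs_nonneg _) ?_ 2
    rw [Matrix.mul_apply]
    calc |∑ k, latentMatrix X₀ i k * E k j| ≤ ∑ k, |latentMatrix X₀ i k * E k j| :=
          Finset.abs_sum_le_sum_abs _ _
      _ ≤ ∑ _k : Fin d, 1 * (1 / n : ℝ) := by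
          refine Finset.sum_le_sum fun k _ => ?_
          rw [abs_mul]
          have h := latent_entry_mem hX₀ i k
          have h' : |latentMatrix X₀ i k| ≤ 1 := by
            have h0 : 0 ≤ latentMatrix X₀ i k := h.1
            rw [abs_of_nonneg h0]; exact h.2
          exact mul_le_mul h' (hE k j) (abs_nonneg _) zero_le_one
      _ = d / n := by simp [div_eq_mul_inv]
  rw [frobNorm_sq_eq_sum]
  calc ∑ i, ∑ j, (latentMatrix X₀ * E) i j ^ 2 ≤ ∑ _i : Fin n, ∑ _j : Fin d, (d / n : ℝ) ^ 2 :=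
        Finset.sum_le_sum fun i _ => Finset.sum_le_sum fun j _ => hentry i j
    _ = d ^ 3 / n := by
        simp only [Finset.sum_const, Finset.card_univ, Fintype.card_fin, nsmul_eq_mul]
        field_simp

/-- By the alignment inequality, a Gaussian weight in the distance of `X Xᵀ` from `X₀ X₀ᵀ` is
dominated by a sum of Gaussians in `X`, one for each grid matrix. -/
lemma exp_neg_gramDiff_le_sum {n d : ℕ} (hn : 1 ≤ n) {X₀ : Fin n → EuclideanSpace ℝ (Fin d)}
    (hX₀ : X₀ ∈ latentFamilies n d) {ρ κ : ℝ} (hρ : 0 ≤ ρ) (hκ : 0 ≤ κ)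
    (hZ : ((latentMatrix X₀)ᵀ * latentMatrix X₀ -
      (ρ * n) • (1 : Matrix (Fin d) (Fin d) ℝ)).PosSemidef)
    (X : Fin n → EuclideanSpace ℝ (Fin d)) :
    Real.exp (-κ * frobNorm (gramDiff X X₀) ^ 2) ≤ ∑ g : Fin d → Fin d → Fin (2 * n + 1),
      Real.exp (κ * ρ * d ^ 3 / 2) * ∏ i, Real.exp (-(κ * ρ * n / 4) *
        ‖X i - WithLp.toLp 2 ((latentMatrix X₀ * gridMatrix n g) i)‖ ^ 2) := by
  have hn' : (0 : ℝ) < n := by exact_mod_cast hn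
  obtain ⟨W, hW, hWle⟩ := exists_orthogonal_frobNorm_sub_le (latentMatrix X) (latentMatrix X₀) hZ
  choose g hg using fun i j => exists_gridPoint_near hn (entry_mem_Icc_of_orthogonal hW i j).1
    (entry_mem_Icc_of_orthogonal hW i j).2
  set G := gridMatrix n g with hG
  have hE := frobNorm_sq_mul_le hn hX₀ (E := W - G) fun i j => hg i j
  have htri : frobNorm (latentMatrix X - latentMatrix X₀ * G) ^ 2
      ≤ 2 * frobNorm (latentMatrix X - latentMatrix X₀ * W) ^ 2
        + 2 * frobNorm (latentMatrix X₀ * (W - G)) ^ 2 := by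
    simp only [frobNorm_sq_eq_sum, Finset.mul_sum, ← Finset.sum_add_distrib]
    refine Finset.sum_le_sum fun i _ => Finset.sum_le_sum fun j _ => ?_
    rw [Matrix.mul_sub]
    simp only [Matrix.sub_apply]
    nlinarith [sq_nonneg ((latentMatrix X i j - (latentMatrix X₀ * W) i j) -
      ((latentMatrix X₀ * W) i j - (latentMatrix X₀ * G) i j))]
  refine le_trans ?_ (Finset.single_le_sum (fun g _ => by positivity) (Finset.mem_univ g))
  rw [← Real.exp_sum, ← Finset.mul_sum, ← hG, ← frobNorm_sq_sub_eq_sum_norm, ← Real.exp_add]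
  apply Real.exp_le_exp.2
  set P := frobNorm (latentMatrix X - latentMatrix X₀ * W) ^ 2
  set P' := frobNorm (latentMatrix X - latentMatrix X₀ * G) ^ 2
  have h1 : P' ≤ 2 * P + 2 * (d ^ 3 / n) := by linarith
  have h2 : κ * ρ * n / 4 * P' ≤ κ * ρ * n / 4 * (2 * P + 2 * (d ^ 3 / n)) := by gcongr
  have h3 : κ * (ρ * n / 2 * P) ≤ κ * frobNorm (gramDiff X X₀) ^ 2 := by
    gcongr; exact hWle
  have h4 : κ * ρ * n / 4 * (2 * P + 2 * (d ^ 3 / n)) = κ * (ρ * n / 2 * P) + κ * ρ * d ^ 3 / 2 := by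
    field_simp
    ring
  linarith

lemma lintegral_exp_neg_gramDiff_le {n d : ℕ} (hn : 1 ≤ n) {f : EuclideanSpace ℝ (Fin d) → ℝ}
    (hf : IsPriorDensity f) {b : ℝ} (hb : 0 ≤ b) (hfb : ∀ x, f x ≤ b)
    {X₀ : Fin n → EuclideanSpace ℝ (Fin d)} (hX₀ : X₀ ∈ latentFamilies n d) {ρ κ : ℝ} (hρ : 0 < ρ)
    (hκ : 0 < κ) (hZ : ((latentMatrix X₀)ᵀ * latentMatrix X₀ -
      (ρ * n) • (1 : Matrix (Fin d) (Fin d) ℝ)).PosSemidef) :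
    ∫⁻ X, ENNReal.ofReal (Real.exp (-κ * frobNorm (gramDiff X X₀) ^ 2)) ∂(rdpgPrior n f)
      ≤ ENNReal.ofReal ((2 * n + 1) ^ (d * d) * (Real.exp (κ * ρ * d ^ 3 / 2) *
        (b * Real.sqrt (Real.pi / (κ * ρ * n / 4)) ^ d) ^ n)) := by
  have hn' : (0 : ℝ) < n := by exact_mod_cast hn
  have := hf.isProbabilityMeasure
  have hc : 0 < κ * ρ * n / 4 := by positivity
  calc _ ≤ ∫⁻ X, ∑ g : Fin d → Fin d → Fin (2 * n + 1),
          ENNReal.ofReal (Real.exp (κ * ρ * d ^ 3 / 2)) * ∏ i, ENNReal.ofReal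
            (Real.exp (-(κ * ρ * n / 4) *
              ‖X i - WithLp.toLp 2 ((latentMatrix X₀ * gridMatrix n g) i)‖ ^ 2))
          ∂(rdpgPrior n f) := by
        refine lintegral_mono fun X => ?_
        refine (ENNReal.ofReal_le_ofReal
          (exp_neg_gramDiff_le_sum hn hX₀ hρ.le hκ.le hZ X)).trans (le_of_eq ?_)
        rw [ENNReal.ofReal_sum_of_nonneg fun g _ => by positivity]
        refine Finset.sum_congr rfl fun g _ => ?_
        rw [ENNReal.ofReal_mul (by positivity),
          ENNReal.ofReal_prod_of_nonneg fun i _ => by positivity]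
    _ = ∑ g : Fin d → Fin d → Fin (2 * n + 1), ENNReal.ofReal (Real.exp (κ * ρ * d ^ 3 / 2)) *
          ∏ i, ∫⁻ x, ENNReal.ofReal (Real.exp (-(κ * ρ * n / 4) *
            ‖x - WithLp.toLp 2 ((latentMatrix X₀ * gridMatrix n g) i)‖ ^ 2))
            ∂(volume.withDensity fun x => ENNReal.ofReal (f x)) := by
        rw [lintegral_finsetSum _ fun g _ => by fun_prop]
        refine Finset.sum_congr rfl fun g _ => ?_
        rw [lintegral_const_mul _ (by fun_prop), rdpgPrior]
        rw [lintegral_pi_prod _ (fun i x => ENNReal.ofReal (Real.exp (-(κ * ρ * n / 4) *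
            ‖x - WithLp.toLp 2 ((latentMatrix X₀ * gridMatrix n g) i)‖ ^ 2)))
            fun i => by fun_prop]
    _ ≤ ∑ _g : Fin d → Fin d → Fin (2 * n + 1), ENNReal.ofReal (Real.exp (κ * ρ * d ^ 3 / 2)) *
          ∏ _i : Fin n, ENNReal.ofReal (b * Real.sqrt (Real.pi / (κ * ρ * n / 4)) ^ d) := by
        gcongr with g _ i _
        exact lintegral_withDensity_gaussian_le hf.measurable hb hfb hc _
    _ = _ := by
        rw [Finset.sum_const, Finset.prod_const, Finset.card_univ, Finset.card_univ,
          ← ENNReal.ofReal_pow (by positivity), ← ENNReal.ofReal_mul (by positivity), nsmul_eq_mul,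
          ← ENNReal.ofReal_natCast, ← ENNReal.ofReal_mul (by positivity)]
        simp [pow_mul]

/-! ### A neighbourhood of the true latent positions -/

/-- The product of the cubes of side `h` whose lower corners are the points `X₀ i`. -/
def cornerNhd {n d : ℕ} (X₀ : Fin n → EuclideanSpace ℝ (Fin d)) (h : ℝ) :
    Set (Fin n → EuclideanSpace ℝ (Fin d)) :=
  Set.pi Set.univ fun i => cornerBox (X₀ i) h

lemma measurableSet_cornerNhd {n d : ℕ} (X₀ : Fin n → EuclideanSpace ℝ (Fin d)) (h : ℝ) :
    MeasurableSet (cornerNhd X₀ h) :=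
  MeasurableSet.univ_pi fun _ => measurableSet_cornerBox _ _

lemma norm_sub_le_of_mem_cornerBox {d : ℕ} {m x : EuclideanSpace ℝ (Fin d)} {h : ℝ} (hh : 0 ≤ h)
    (hx : x ∈ cornerBox m h) : ‖x - m‖ ≤ d * h := by
  refine abs_le_of_sq_le_sq' ?_ (by positivity) |>.2
  rw [EuclideanSpace.norm_sq_eq]
  calc ∑ k, ‖(x - m) k‖ ^ 2 ≤ ∑ _k : Fin d, h ^ 2 := by
        refine Finset.sum_le_sum fun k _ => ?_
        have := hx k
        rw [Real.norm_eq_abs, sq_abs, PiLp.sub_apply]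
        nlinarith [this.1, this.2]
    _ = d * h ^ 2 := by simp
    _ ≤ (d * h) ^ 2 := by
        rw [mul_pow]
        gcongr
        rcases Nat.eq_zero_or_pos d with rfl | hd
        · simp
        · have : (1 : ℝ) ≤ d := by exact_mod_cast hd
          nlinarith

/-- Close to `X₀`, in the corner neighbourhood, the families are latent and the edge probabilities
are close to those of `X₀`. -/
lemma cornerNhd_properties {n d : ℕ} {X₀ : Fin n → EuclideanSpace ℝ (Fin d)}
    (hX₀ : X₀ ∈ latentFamilies n d) {δ : ℝ} (hδ : 0 < δ)
    (hb : ∀ i j, δ ≤ inner ℝ (X₀ i) (X₀ j) ∧ inner ℝ (X₀ i) (X₀ j) ≤ 1 - δ) {h : ℝ} (hh : 0 ≤ h)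
    (hdh : d * h ≤ δ / 6) {X : Fin n → EuclideanSpace ℝ (Fin d)} (hX : X ∈ cornerNhd X₀ h) :
    X ∈ latentFamilies n d ∧ ∀ p, |edgeProb X₀ p - edgeProb X p| ≤ 2 * (d * h) := by
  have hdist : ∀ i, ‖X i - X₀ i‖ ≤ d * h := fun i =>
    norm_sub_le_of_mem_cornerBox hh (hX i (Set.mem_univ i))
  have hlat : X ∈ latentFamilies n d := by
    intro i
    refine ⟨?_, fun k => ((hX₀ i).2 k).trans (hX i (Set.mem_univ i) k).1⟩
    have h1 : ‖X₀ i‖ ≤ 1 - δ / 2 := by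
      have h2 := (hb i i)
      rw [real_inner_self_eq_norm_sq] at h2
      nlinarith [norm_nonneg (X₀ i), hδ]
    have h3 : ‖X i‖ ≤ ‖X₀ i‖ + ‖X i - X₀ i‖ := norm_le_insert' (X i) (X₀ i)
    linarith [hdist i]
  refine ⟨hlat, fun p => ?_⟩
  have e : edgeProb X₀ p - edgeProb X p
      = -(inner ℝ (X p.1.1 - X₀ p.1.1) (X p.1.2) + inner ℝ (X₀ p.1.1) (X p.1.2 - X₀ p.1.2)) := by
    simp only [edgeProb, inner_sub_left, inner_sub_right]; ring
  have e1 := abs_real_inner_le_norm (X p.1.1 - X₀ p.1.1) (X p.1.2)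
  have e2 := abs_real_inner_le_norm (X₀ p.1.1) (X p.1.2 - X₀ p.1.2)
  have e3 := abs_add_le (inner ℝ (X p.1.1 - X₀ p.1.1) (X p.1.2))
    (inner ℝ (X₀ p.1.1) (X p.1.2 - X₀ p.1.2))
  have f1 : ‖X p.1.1 - X₀ p.1.1‖ * ‖X p.1.2‖ ≤ d * h * 1 :=
    mul_le_mul (hdist _) (hlat _).1 (norm_nonneg _) (by positivity)
  have f2 : ‖X₀ p.1.1‖ * ‖X p.1.2 - X₀ p.1.2‖ ≤ 1 * (d * h) :=
    mul_le_mul (hX₀ _).1 (hdist _) (norm_nonneg _) zero_le_one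
  rw [e, abs_neg]
  linarith

lemma le_rdpgPrior_cornerNhd {n d : ℕ} {f : EuclideanSpace ℝ (Fin d) → ℝ} (hf : IsPriorDensity f)
    {a : ℝ} (ha : 0 ≤ a) (hfa : ∀ x ∈ latentSpace d, a ≤ f x)
    {X₀ : Fin n → EuclideanSpace ℝ (Fin d)} {h : ℝ} (hh : 0 ≤ h)
    (hsub : cornerNhd X₀ h ⊆ latentFamilies n d) :
    ENNReal.ofReal ((a * h ^ d) ^ n) ≤ rdpgPrior n f (cornerNhd X₀ h) := by
  classical
  have := hf.isProbabilityMeasure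
  rw [rdpgPrior, cornerNhd, Measure.pi_pi, ENNReal.ofReal_pow (by positivity)]
  calc ENNReal.ofReal (a * h ^ d) ^ n = ∏ _i : Fin n, ENNReal.ofReal (a * h ^ d) := by simp
    _ ≤ _ := by
      gcongr with i _
      refine le_withDensity_cornerBox ha hh fun x hx => hfa x ?_
      have hX : Function.update X₀ i x ∈ cornerNhd X₀ h := by
        intro j _
        rcases eq_or_ne j i with rfl | hj
        · simpa using hx
        · rw [Function.update_of_ne hj]
          exact fun k => ⟨le_rfl, by linarith⟩
      simpa using hsub hX i

/-- The second moment of the likelihood ratio is at most `exp n` at every family of the corner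
neighbourhood whose side is of order `1 / √n`. -/
lemma sum_bernoulliWeight_sq_div_le_exp {n d : ℕ} (hn : 1 ≤ n)
    {X₀ : Fin n → EuclideanSpace ℝ (Fin d)}
    (hX₀ : X₀ ∈ latentFamilies n d) {δ : ℝ} (hδ : 0 < δ) (hδ' : δ < 1 / 2)
    (hb : ∀ i j, δ ≤ inner ℝ (X₀ i) (X₀ j) ∧ inner ℝ (X₀ i) (X₀ j) ≤ 1 - δ) {h : ℝ} (hh : 0 ≤ h)
    (hdh : d * h ≤ δ / (6 * Real.sqrt n)) {X : Fin n → EuclideanSpace ℝ (Fin d)}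
    (hX : X ∈ cornerNhd X₀ h) :
    X ∈ latentFamilies n d ∧ (∀ p, 0 < edgeProb X p ∧ edgeProb X p < 1) ∧
      ∑ y, bernoulliWeight (edgeProb X₀) y *
        (bernoulliWeight (edgeProb X₀) y / bernoulliWeight (edgeProb X) y) ≤ Real.exp n := by
  have hn' : (1 : ℝ) ≤ n := by exact_mod_cast hn
  have hs1 : 1 ≤ Real.sqrt n := Real.one_le_sqrt.2 hn'
  have hs2 : Real.sqrt n ^ 2 = n := Real.sq_sqrt (by linarith)
  have hdh' : d * h ≤ δ / 6 := hdh.trans (by gcongr; linarith)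
  obtain ⟨hlat, hclose⟩ := cornerNhd_properties hX₀ hδ hb hh hdh' hX
  have hrange : ∀ p, δ / 2 ≤ edgeProb X p ∧ edgeProb X p ≤ 1 - δ / 2 := by
    intro p
    have h1 := abs_le.1 (hclose p)
    have h2 : δ ≤ edgeProb X₀ p ∧ edgeProb X₀ p ≤ 1 - δ := hb _ _
    constructor <;> linarith [h1.1, h1.2, h2.1, h2.2]
  have hpos : ∀ p, 0 < edgeProb X p ∧ edgeProb X p < 1 := fun p =>
    ⟨by linarith [(hrange p).1], by linarith [(hrange p).2]⟩
  refine ⟨hlat, hpos, ?_⟩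
  refine (sum_bernoulliWeight_sq_div_le (κ := 1 / n) fun p => ⟨(hpos p).1, (hpos p).2, ?_⟩).trans ?_
  · have h1 : (edgeProb X₀ p - edgeProb X p) ^ 2 ≤ (2 * (δ / (6 * Real.sqrt n))) ^ 2 := by
      rw [← sq_abs]
      exact pow_le_pow_left₀ (abs_nonneg _) ((hclose p).trans (by linarith)) 2
    have h2 : (2 * (δ / (6 * Real.sqrt n))) ^ 2 = 1 / n * (δ ^ 2 / 9) := by
      rw [mul_pow, div_pow, mul_pow, hs2]; field_simp; norm_num
    rw [h2] at h1
    refine h1.trans ?_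
    gcongr
    nlinarith [(hrange p).1, (hrange p).2]
  · apply Real.exp_le_exp.2
    have hcard : Fintype.card (UpperPair n) ≤ n * n := by
      have := Fintype.card_subtype_le fun p : Fin n × Fin n => p.1 ≤ p.2
      simpa using this
    have hcard' : (Fintype.card (UpperPair n) : ℝ) ≤ n * n := by exact_mod_cast hcard
    calc (Fintype.card (UpperPair n) : ℝ) * (1 / n) ≤ n * n * (1 / n) := by gcongr
      _ = n := by field_simp

/-! ### The posterior bound at a fixed sample size -/

lemma continuous_edgeProb {n d : ℕ} (p : UpperPair n) :
    Continuous fun X : Fin n → EuclideanSpace ℝ (Fin d) => edgeProb X p := by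
  unfold edgeProb
  fun_prop

lemma continuous_bernoulliWeight_edgeProb {n d : ℕ} (y : UpperPair n → Bool) :
    Continuous fun X : Fin n → EuclideanSpace ℝ (Fin d) => bernoulliWeight (edgeProb X) y := by
  unfold bernoulliWeight
  refine continuous_finsetProd _ fun p _ => ?_
  have := continuous_edgeProb (n := n) (d := d) p
  split_ifs <;> fun_prop

lemma continuous_frobNorm {m n : ℕ} :
    Continuous fun A : Matrix (Fin m) (Fin n) ℝ => frobNorm A := by
  have h : (fun A : Matrix (Fin m) (Fin n) ℝ => frobNorm A)
      = fun A => Real.sqrt (∑ i, ∑ j, A i j ^ 2) := by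
    ext A
    rw [← frobNorm_sq_eq_sum, Real.sqrt_sq (frobNorm_nonneg A)]
  rw [h]
  have h (i : Fin m) (j : Fin n) : Continuous fun A : Matrix (Fin m) (Fin n) ℝ => A i j := continuous_id.matrix_elem i j
  fun_prop

lemma continuous_frobNorm_gramDiff {n d : ℕ} (X₀ : Fin n → EuclideanSpace ℝ (Fin d)) :
    Continuous fun X => frobNorm (gramDiff X X₀) := by
  refine continuous_frobNorm.comp (continuous_matrix fun i j => ?_)
  simp only [gramDiff, Matrix.sub_apply, latentMatrix_mul_transpose_apply]
  fun_prop

lemma measurableSet_latentFamilies (n d : ℕ) : MeasurableSet (latentFamilies n d) := by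
  have : latentFamilies n d = ⋂ i, {X | ‖X i‖ ≤ 1} ∩ ⋂ k, {X | 0 ≤ X i k} := by
    ext X
    simp [latentFamilies, latentSpace]
  rw [this]
  refine MeasurableSet.iInter fun i => MeasurableSet.inter ?_ (MeasurableSet.iInter fun k => ?_)
  · exact measurableSet_le (by fun_prop) measurable_const
  · exact measurableSet_le measurable_const (by fun_prop)

/-- The set of latent families at a gram loss larger than `M / √n` from `X₀`. -/
def farSet {n d : ℕ} (X₀ : Fin n → EuclideanSpace ℝ (Fin d)) (M : ℝ) :
    Set (Fin n → EuclideanSpace ℝ (Fin d)) :=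
  {X | X ∈ latentFamilies n d ∧ gramLoss X X₀ > M / Real.sqrt n}

lemma measurableSet_farSet {n d : ℕ} (X₀ : Fin n → EuclideanSpace ℝ (Fin d)) (M : ℝ) :
    MeasurableSet (farSet X₀ M) := by
  have h : MeasurableSet {X | M / Real.sqrt n < gramLoss X X₀} := by
    simp only [gramLoss_eq]
    exact measurableSet_lt measurable_const
      ((continuous_frobNorm_gramDiff X₀).measurable.const_mul _)
  exact (measurableSet_latentFamilies n d).inter h

lemma evidence_eq {n d : ℕ} (f : EuclideanSpace ℝ (Fin d) → ℝ)
    {X₀ : Fin n → EuclideanSpace ℝ (Fin d)} (h : ∀ p, 0 < edgeProb X₀ p ∧ edgeProb X₀ p < 1)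
    (Y : Matrix (Fin n) (Fin n) Bool) (A : Set (Fin n → EuclideanSpace ℝ (Fin d))) :
    evidence f X₀ Y A = ∫⁻ X in A, ENNReal.ofReal (bernoulliWeight (edgeProb X) (upperEntries Y)) /
      ENNReal.ofReal (bernoulliWeight (edgeProb X₀) (upperEntries Y)) ∂(rdpgPrior n f) := by
  refine lintegral_congr fun X => ?_
  rw [likelihoodRatio_eq, ENNReal.ofReal_div_of_pos
    (bernoulliWeight_pos (fun p => (h p).1) (fun p => (h p).2) _)]

/-- The prior integral of the errors of the second kind over the far set. The constant `κ` is half of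
the constant in the exponent of `sum_compl_rejectSet_le`. -/
lemma lintegral_farSet_le {n d : ℕ} (hn : 1 ≤ n) (hd : 1 ≤ d) {f : EuclideanSpace ℝ (Fin d) → ℝ}
    (hf : IsPriorDensity f) {b : ℝ} (hb : 0 ≤ b) (hfb : ∀ x, f x ≤ b)
    {X₀ : Fin n → EuclideanSpace ℝ (Fin d)} (hX₀ : X₀ ∈ latentFamilies n d) {ρ K κ : ℝ}
    (hρ : 0 < ρ) (hK : 0 ≤ K) (hκ : κ = 1 / (4096 * d ^ 2))
    (hZ : ((latentMatrix X₀)ᵀ * latentMatrix X₀ -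
      (ρ * n) • (1 : Matrix (Fin d) (Fin d) ℝ)).PosSemidef)
    {N : Finset (Fin n → ℝ)} (hN : ∀ v ∈ N, v ⬝ᵥ v ≤ 1)
    (hnet : ∀ u : Fin n → ℝ, u ⬝ᵥ u ≤ 1 →
      ∃ v ∈ N, (v - u) ⬝ᵥ (v - u) ≤ (1 / (8 * d : ℕ) : ℝ) ^ 2) :
    ∫⁻ X in farSet X₀ (16 * d * K), ∑ y ∈ (rejectSet X₀ N (K * Real.sqrt n))ᶜ,
        ENNReal.ofReal (bernoulliWeight (edgeProb X) y) ∂(rdpgPrior n f)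
      ≤ ENNReal.ofReal (2 * Real.exp (-(K ^ 2 * n / 16)) * ((2 * n + 1) ^ (d * d) *
        (Real.exp (κ * ρ * d ^ 3 / 2) *
          (b * Real.sqrt (Real.pi / (κ * ρ * n / 4)) ^ d) ^ n))) := by
  have hd' : (0 : ℝ) < d := by exact_mod_cast hd
  have hκ0 : 0 < κ := by rw [hκ]; positivity
  have hpoint : ∀ X ∈ farSet X₀ (16 * d * K),
      ∑ y ∈ (rejectSet X₀ N (K * Real.sqrt n))ᶜ, ENNReal.ofReal (bernoulliWeight (edgeProb X) y)
        ≤ ENNReal.ofReal (2 * Real.exp (-(K ^ 2 * n / 16))) *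
          ENNReal.ofReal (Real.exp (-κ * frobNorm (gramDiff X X₀) ^ 2)) := by
    intro X hX
    have hq := edgeProb_mem_of_latent hX.1
    have hfar : 16 * d * K * Real.sqrt n < frobNorm (gramDiff X X₀) :=
      not_le.1 fun h => not_le.2 hX.2 ((gramLoss_le_iff hn X X₀ _).2 h)
    rw [← ENNReal.ofReal_sum_of_nonneg fun y _ =>
      bernoulliWeight_nonneg (fun p => (hq p).1) (fun p => (hq p).2) y,
      ← ENNReal.ofReal_mul (by positivity)]
    refine ENNReal.ofReal_le_ofReal ((sum_compl_rejectSet_le hd hX.1 hN hnet (by positivity)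
      (by rwa [← mul_assoc])).trans ?_)
    rw [mul_assoc, ← Real.exp_add]
    gcongr
    -- half of the exponent is spent on the constant, the other half on the Gaussian factor
    have h1 : (16 * d * K * Real.sqrt n) ^ 2 ≤ frobNorm (gramDiff X X₀) ^ 2 :=
      pow_le_pow_left₀ (by positivity) hfar.le 2
    rw [mul_pow, Real.sq_sqrt (by positivity)] at h1
    have h2 : K ^ 2 * n / 16 ≤ κ * frobNorm (gramDiff X X₀) ^ 2 := by
      calc K ^ 2 * n / 16 = κ * ((16 * d * K) ^ 2 * n) := by rw [hκ]; field_simp; ring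
        _ ≤ _ := by gcongr
    have h3 : frobNorm (gramDiff X X₀) ^ 2 / (2048 * d ^ 2)
        = 2 * (κ * frobNorm (gramDiff X X₀) ^ 2) := by rw [hκ]; field_simp; ring
    rw [h3]
    linarith
  calc _ ≤ ∫⁻ X in farSet X₀ (16 * d * K), ENNReal.ofReal (2 * Real.exp (-(K ^ 2 * n / 16))) *
          ENNReal.ofReal (Real.exp (-κ * frobNorm (gramDiff X X₀) ^ 2)) ∂(rdpgPrior n f) :=
        setLIntegral_mono' (measurableSet_farSet _ _) hpoint
    _ ≤ ∫⁻ X, ENNReal.ofReal (2 * Real.exp (-(K ^ 2 * n / 16))) *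
          ENNReal.ofReal (Real.exp (-κ * frobNorm (gramDiff X X₀) ^ 2)) ∂(rdpgPrior n f) :=
        setLIntegral_le_lintegral _ _
    _ ≤ _ := by
        rw [lintegral_const_mul' _ _ ENNReal.ofReal_ne_top,
          ENNReal.ofReal_mul (p := 2 * Real.exp _) (by positivity)]
        gcongr
        exact lintegral_exp_neg_gramDiff_le hn hf hb hfb hX₀ hρ hκ0 hZ

/-- The expected posterior mass of the far set. The three terms are the error of the first kind of
the test, the probability of a small denominator, and the error of the second kind divided by the
lower bound for the denominator. -/
lemma lintegral_posterior_farSet_le {n d : ℕ} (hn : 1 ≤ n) (hd : 1 ≤ d)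
    {f : EuclideanSpace ℝ (Fin d) → ℝ} (hf : IsPriorDensity f) {a b : ℝ} (ha : 0 < a) (hb : 0 ≤ b)
    (hfa : ∀ x ∈ latentSpace d, a ≤ f x) (hfb : ∀ x, f x ≤ b)
    {X₀ : Fin n → EuclideanSpace ℝ (Fin d)} (hX₀ : X₀ ∈ latentFamilies n d) {δ : ℝ} (hδ : 0 < δ)
    (hδ' : δ < 1 / 2)
    (hbd : ∀ i j, δ ≤ inner ℝ (X₀ i) (X₀ j) ∧ inner ℝ (X₀ i) (X₀ j) ≤ 1 - δ) {ρ K κ h : ℝ}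
    (hρ : 0 < ρ) (hK : 0 ≤ K) (hκ : κ = 1 / (4096 * d ^ 2)) (hh : h = δ / (6 * d * Real.sqrt n))
    (hZ : ((latentMatrix X₀)ᵀ * latentMatrix X₀ -
      (ρ * n) • (1 : Matrix (Fin d) (Fin d) ℝ)).PosSemidef)
    {Ω : Type*} [MeasurableSpace Ω] (P : Measure Ω) [IsProbabilityMeasure P]
    (Y : Ω → Matrix (Fin n) (Fin n) Bool) (hY : IsRDPG P X₀ Y) :
    ∫⁻ ω, rdpgPosterior f X₀ (Y ω) (farSet X₀ (16 * d * K)) ∂P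
      ≤ ENNReal.ofReal ((3 * 2 ^ (8 * d)) ^ n * (2 * Real.exp (-(K ^ 2 * n / 8)))
        + Real.exp (-(n * d))
        + 2 * Real.exp (-(K ^ 2 * n / 16)) * ((2 * n + 1) ^ (d * d) *
          (Real.exp (κ * ρ * d ^ 3 / 2) *
            (b * Real.sqrt (Real.pi / (κ * ρ * n / 4)) ^ d) ^ n))
          / ((a * h ^ d) ^ n * Real.exp (-(n + n * d)))) := by
  have hd' : (0 : ℝ) < d := by exact_mod_cast hd
  have hn' : (0 : ℝ) < n := by exact_mod_cast hn
  have hs : 0 < Real.sqrt n := Real.sqrt_pos.2 hn'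
  have hh0 : 0 < h := by rw [hh]; positivity
  have hdh : d * h ≤ δ / (6 * Real.sqrt n) := by
    rw [hh]; exact le_of_eq (by field_simp)
  have hκ0 : 0 < κ := by rw [hκ]; positivity
  have hq₀ : ∀ p, 0 < edgeProb X₀ p ∧ edgeProb X₀ p < 1 := fun p =>
    ⟨hδ.trans_le (hbd _ _).1, (hbd _ _).2.trans_lt (by linarith)⟩
  obtain ⟨N, hNcard, hN, hnet⟩ := exists_net_unitBall n (8 * d) (by omega)
  have hB := fun X (hX : X ∈ cornerNhd X₀ h) =>
    sum_bernoulliWeight_sq_div_le_exp hn hX₀ hδ hδ' hbd hh0.le hdh hX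
  have hBsub : cornerNhd X₀ h ⊆ latentFamilies n d := fun X hX => (hB X hX).1
  have hprior := le_rdpgPrior_cornerNhd hf ha.le hfa hh0.le hBsub
  set ν := rdpgPrior n f with hν
  have hνprob : IsProbabilityMeasure ν := by
    have := hf.isProbabilityMeasure
    rw [hν, rdpgPrior]; infer_instance
  have hνB : ν (cornerNhd X₀ h) ≠ 0 := by
    refine (lt_of_lt_of_le ?_ hprior).ne'
    exact ENNReal.ofReal_pos.2 (by positivity)
  have hw₀ : ∀ y, 0 < bernoulliWeight (edgeProb X₀) y :=
    bernoulliWeight_pos (fun p => (hq₀ p).1) (fun p => (hq₀ p).2)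
  set τ := ν (cornerNhd X₀ h) * ENNReal.ofReal (Real.exp (-(n + n * d))) with hτ
  have hexp0 : ENNReal.ofReal (Real.exp (-(n + n * d : ℝ))) ≠ 0 :=
    (ENNReal.ofReal_pos.2 (Real.exp_pos _)).ne'
  have key := sum_mul_posterior_le ν (fun y => ENNReal.ofReal (bernoulliWeight (edgeProb X₀) y))
    (fun X y => ENNReal.ofReal (bernoulliWeight (edgeProb X) y))
    (fun y => (continuous_bernoulliWeight_edgeProb y).measurable.ennreal_ofReal)
    (fun y => ⟨(ENNReal.ofReal_pos.2 (hw₀ y)).ne', ENNReal.ofReal_ne_top⟩)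
    (A := farSet X₀ (16 * d * K)) (fun X hX => hX.1) hBsub (measurableSet_cornerNhd X₀ h)
    (rejectSet X₀ N (K * Real.sqrt n)) (τ := τ) (χ := ENNReal.ofReal (Real.exp n))
    (mul_ne_zero hνB hexp0) (ENNReal.mul_ne_top (measure_ne_top _ _) ENNReal.ofReal_ne_top)
    hνB (measure_ne_top _ _)
    (fun X hX y => ⟨(ENNReal.ofReal_pos.2 (bernoulliWeight_pos (fun p => ((hB X hX).2.1 p).1)
      (fun p => ((hB X hX).2.1 p).2) y)).ne', ENNReal.ofReal_ne_top⟩)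
    (fun X hX => by
      have hpos := bernoulliWeight_pos (fun p => ((hB X hX).2.1 p).1)
        (fun p => ((hB X hX).2.1 p).2)
      refine le_trans (le_of_eq ?_) (ENNReal.ofReal_le_ofReal (hB X hX).2.2)
      rw [ENNReal.ofReal_sum_of_nonneg fun y _ => by
        have := hpos y; have := hw₀ y; positivity]
      refine Finset.sum_congr rfl fun y _ => ?_
      rw [ENNReal.ofReal_mul (hw₀ y).le, ENNReal.ofReal_div_of_pos (hpos y)])
  set F : (UpperPair n → Bool) → ℝ≥0∞ := fun y =>
    (∫⁻ X in farSet X₀ (16 * d * K), ENNReal.ofReal (bernoulliWeight (edgeProb X) y) /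
        ENNReal.ofReal (bernoulliWeight (edgeProb X₀) y) ∂ν) /
      ∫⁻ X in latentFamilies n d, ENNReal.ofReal (bernoulliWeight (edgeProb X) y) /
        ENNReal.ofReal (bernoulliWeight (edgeProb X₀) y) ∂ν with hF
  have hpost : ∀ ω, rdpgPosterior f X₀ (Y ω) (farSet X₀ (16 * d * K))
      = F (upperEntries (Y ω)) := by
    intro ω
    rw [rdpgPosterior, evidence_eq f hq₀, evidence_eq f hq₀]
  rw [lintegral_congr hpost, hY.lintegral_upperEntries (fun p => (hq₀ p).1.le)
    (fun p => (hq₀ p).2.le) F]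
  refine key.trans ?_
  rw [ENNReal.ofReal_add (by positivity) (by positivity),
    ENNReal.ofReal_add (by positivity) (by positivity)]
  refine add_le_add (add_le_add ?_ ?_) ?_
  · rw [← ENNReal.ofReal_sum_of_nonneg fun y _ => (hw₀ y).le]
    refine ENNReal.ofReal_le_ofReal ((sum_rejectSet_le hX₀ hN (by positivity)).trans ?_)
    rw [mul_pow, Real.sq_sqrt hn'.le]
    gcongr
  · rw [hτ, mul_comm (ν _), mul_assoc, ENNReal.mul_div_cancel hνB (measure_ne_top _ _),
      ← ENNReal.ofReal_mul (by positivity), ← Real.exp_add]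
    exact ENNReal.ofReal_le_ofReal (Real.exp_le_exp.2 (by linarith))
  · rw [hτ, ENNReal.ofReal_div_of_pos (by positivity),
      ENNReal.ofReal_mul (by positivity) (p := _ ^ n)]
    gcongr
    exact lintegral_farSet_le hn hd hf hb hfb hX₀ hρ hK hκ hZ hN hnet

/-! ### Choice of the constants -/

/-- The bound of `lintegral_posterior_farSet_le` is small when `K` is large. Here `R` is the ratio per
row of the Gaussian integral in the numerator to the prior mass of a cube in the denominator. -/
lemma rate_bound {n d : ℕ} (hn : 1 ≤ n) (hd : 1 ≤ d) {a b δ ρ κ h K R : ℝ} (ha : 0 < a) (hb : 0 < b)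
    (hδ : 0 < δ) (hρ : 0 < ρ) (hκ : 0 < κ) (hh : h = δ / (6 * d * Real.sqrt n))
    (hR : R = b / a * (Real.sqrt (4 * Real.pi / (κ * ρ)) * (6 * d / δ)) ^ d)
    (hK1 : 8 * (2 + 9 * d) ≤ K ^ 2) (hK2 : 16 * (2 + R + 2 * d) ≤ K ^ 2)
    (hpoly : (2 * n + 1 : ℝ) ^ (d * d) * Real.exp (κ * ρ * d ^ 3 / 2) ≤ Real.exp n) :
    (3 * 2 ^ (8 * d)) ^ n * (2 * Real.exp (-(K ^ 2 * n / 8))) + Real.exp (-(n * d))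
        + 2 * Real.exp (-(K ^ 2 * n / 16)) * ((2 * n + 1) ^ (d * d) *
          (Real.exp (κ * ρ * d ^ 3 / 2) *
            (b * Real.sqrt (Real.pi / (κ * ρ * n / 4)) ^ d) ^ n))
          / ((a * h ^ d) ^ n * Real.exp (-(n + n * d)))
      ≤ 8 * Real.exp (-(1 / 2) * n * d) := by
  have hd' : (0 : ℝ) < d := by exact_mod_cast hd
  have hn' : (0 : ℝ) < n := by exact_mod_cast hn
  have hs : 0 < Real.sqrt n := Real.sqrt_pos.2 hn'
  have hh0 : 0 < h := by rw [hh]; positivity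
  have t1 : (3 * 2 ^ (8 * d) : ℝ) ^ n * (2 * Real.exp (-(K ^ 2 * n / 8)))
      ≤ 2 * Real.exp (-(1 / 2) * n * d) := by
    have e3 : (3 : ℝ) ≤ Real.exp 2 := by linarith [Real.add_one_le_exp (2 : ℝ)]
    have e2 : (2 : ℝ) ≤ Real.exp 1 := by linarith [Real.add_one_le_exp (1 : ℝ)]
    have e : (3 * 2 ^ (8 * d) : ℝ) ^ n ≤ Real.exp (n * (2 + 8 * d)) := by
      rw [Real.exp_nat_mul, Real.exp_add]
      have : Real.exp (8 * d : ℝ) = Real.exp 1 ^ (8 * d) := by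
        rw [← Real.exp_nat_mul]; push_cast; ring_nf
      rw [this]
      gcongr
    calc _ ≤ Real.exp (n * (2 + 8 * d)) * (2 * Real.exp (-(K ^ 2 * n / 8))) := by gcongr
      _ = 2 * Real.exp (n * (2 + 8 * d) + -(K ^ 2 * n / 8)) := by rw [Real.exp_add]; ring
      _ ≤ _ := by
        gcongr
        nlinarith
  have t2 : Real.exp (-(n * d : ℝ)) ≤ Real.exp (-(1 / 2) * n * d) := by
    apply Real.exp_le_exp.2
    nlinarith [mul_pos hn' hd']
  -- the factors `√n ^ d` from the Gaussian integral and from the side of the cubes cancel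
  have hratio : b * Real.sqrt (Real.pi / (κ * ρ * n / 4)) ^ d = R * (a * h ^ d) := by
    have e1 : Real.pi / (κ * ρ * n / 4) = 4 * Real.pi / (κ * ρ) / n := by
      field_simp
    rw [e1, Real.sqrt_div' _ hn'.le, hR, hh]
    simp only [div_pow, mul_pow]
    field_simp
  have t3 : 2 * Real.exp (-(K ^ 2 * n / 16)) * ((2 * n + 1) ^ (d * d) *
          (Real.exp (κ * ρ * d ^ 3 / 2) *
            (b * Real.sqrt (Real.pi / (κ * ρ * n / 4)) ^ d) ^ n))
          / ((a * h ^ d) ^ n * Real.exp (-(n + n * d))) ≤ 2 * Real.exp (-(1 / 2) * n * d) := by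
    rw [div_le_iff₀ (by positivity), hratio, mul_pow]
    have hR0 : 0 ≤ R := by rw [hR]; positivity
    have eR : R ^ n ≤ Real.exp (n * R) := by
      rw [Real.exp_nat_mul]
      gcongr
      linarith [Real.add_one_le_exp R]
    calc _ = 2 * Real.exp (-(K ^ 2 * n / 16)) * ((2 * n + 1) ^ (d * d) *
            Real.exp (κ * ρ * d ^ 3 / 2)) * R ^ n * (a * h ^ d) ^ n := by ring
      _ ≤ 2 * Real.exp (-(K ^ 2 * n / 16)) * Real.exp n * Real.exp (n * R) *
            (a * h ^ d) ^ n := by gcongr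
      _ = 2 * Real.exp (-(K ^ 2 * n / 16) + n + n * R) * (a * h ^ d) ^ n := by
          rw [Real.exp_add, Real.exp_add]; ring
      _ ≤ 2 * Real.exp (-(1 / 2) * n * d + -(n + n * d)) * (a * h ^ d) ^ n := by
          refine mul_le_mul_of_nonneg_right (mul_le_mul_of_nonneg_left
            (Real.exp_le_exp.2 ?_) two_pos.le) (by positivity)
          nlinarith [mul_le_mul_of_nonneg_left hK2 hn'.le, mul_pos hn' hd']
      _ = _ := by rw [Real.exp_add]; ring
  have := Real.exp_pos (-(1 / 2) * n * d : ℝ)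
  linarith

lemma eventually_poly_le_exp (k : ℕ) (C : ℝ) :
    ∀ᶠ n : ℕ in atTop, (2 * n + 1 : ℝ) ^ k * C ≤ Real.exp n := by
  have h1 : Tendsto (fun x : ℝ => x ^ k * Real.exp (-x)) atTop (𝓝 0) :=
    Real.tendsto_pow_mul_exp_neg_atTop_nhds_zero k
  have h2 : Tendsto (fun n : ℕ => (n : ℝ) ^ k * Real.exp (-(n : ℝ)) * (3 ^ k * |C|)) atTop (𝓝 0) := by
    simpa using (h1.comp tendsto_natCast_atTop_atTop).mul_const (3 ^ k * |C|)
  filter_upwards [h2.eventually (gt_mem_nhds zero_lt_one), eventually_ge_atTop 1] with n hn hn1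
  have hn1' : (1 : ℝ) ≤ n := by exact_mod_cast hn1
  have h3 : (2 * n + 1 : ℝ) ^ k * C ≤ (3 * n) ^ k * |C| := by
    calc _ ≤ (2 * n + 1 : ℝ) ^ k * |C| := by gcongr; exact le_abs_self C
      _ ≤ _ := by gcongr; linarith
  have h4 : (n : ℝ) ^ k * Real.exp (-(n : ℝ)) * (3 ^ k * |C|)
      = (3 * n) ^ k * |C| / Real.exp n := by
    rw [Real.exp_neg, mul_pow]; ring
  rw [h4, div_lt_one (Real.exp_pos _)] at hn
  exact h3.trans hn.le

/-- A positive definite matrix is bounded below by a positive multiple of the identity. -/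
lemma exists_pos_forall_le_dotProduct {d : ℕ} {Δ : Matrix (Fin d) (Fin d) ℝ} (hΔ : Δ.PosDef) :
    ∃ m : ℝ, 0 < m ∧ ∀ v : Fin d → ℝ, m * (v ⬝ᵥ v) ≤ v ⬝ᵥ Δ *ᵥ v := by
  rcases Nat.eq_zero_or_pos d with rfl | hd
  · exact ⟨1, one_pos, fun v => by simp⟩
  have hne : Nonempty (Fin d) := ⟨⟨0, hd⟩⟩
  obtain ⟨k, hk⟩ := Finite.exists_min hΔ.isHermitian.eigenvalues
  refine ⟨hΔ.isHermitian.eigenvalues k, hΔ.eigenvalues_pos k, fun v => ?_⟩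
  set U : Matrix (Fin d) (Fin d) ℝ := hΔ.isHermitian.eigenvectorUnitary.1 with hU
  have hUU : U * Uᵀ = 1 := by
    have := Unitary.coe_mul_star_self hΔ.isHermitian.eigenvectorUnitary
    rwa [Unitary.coe_star, Matrix.star_eq_conjTranspose, Matrix.conjTranspose_eq_transpose_of_trivial] at this
  have hspec : Δ = U * Matrix.diagonal hΔ.isHermitian.eigenvalues * Uᵀ := by
    have := hΔ.isHermitian.spectral_theorem
    rw [Unitary.conjStarAlgAut_apply] at this
    simpa [Matrix.star_eq_conjTranspose] using this
  have e1 : v ⬝ᵥ Δ *ᵥ v = ∑ i, hΔ.isHermitian.eigenvalues i * ((Uᵀ *ᵥ v) i) ^ 2 := by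
    conv_lhs => rw [hspec]
    rw [← Matrix.mulVec_mulVec, ← Matrix.mulVec_mulVec, Matrix.dotProduct_mulVec,
      ← Matrix.mulVec_transpose]
    simp only [dotProduct, Matrix.mulVec_diagonal]
    exact Finset.sum_congr rfl fun i _ => by ring
  have e2 : v ⬝ᵥ v = ∑ i, ((Uᵀ *ᵥ v) i) ^ 2 := by
    have h : v ⬝ᵥ v = v ⬝ᵥ (U * Uᵀ) *ᵥ v := by rw [hUU, Matrix.one_mulVec]
    rw [h, ← Matrix.mulVec_mulVec, Matrix.dotProduct_mulVec, ← Matrix.mulVec_transpose]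
    simp only [dotProduct, sq]
  rw [e1, e2, Finset.mul_sum]
  exact Finset.sum_le_sum fun i _ => mul_le_mul_of_nonneg_right (hk i) (sq_nonneg _)

/-- If the scaled Gram matrices of `X₀ n` converge to a positive definite matrix with lower bound
`m`, then the Gram matrix of `X₀ n` is eventually at least `m n / 2`. -/
lemma eventually_posSemidef_gram_sub {d : ℕ} {Δ : Matrix (Fin d) (Fin d) ℝ} {m : ℝ} (hm : 0 < m)
    (hΔ : ∀ v : Fin d → ℝ, m * (v ⬝ᵥ v) ≤ v ⬝ᵥ Δ *ᵥ v)
    {X₀ : (n : ℕ) → Fin n → EuclideanSpace ℝ (Fin d)}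
    (hlim : Tendsto (fun n : ℕ => (1 / (n : ℝ)) • ((latentMatrix (X₀ n))ᵀ * latentMatrix (X₀ n)))
      atTop (𝓝 Δ)) :
    ∀ᶠ n : ℕ in atTop, ((latentMatrix (X₀ n))ᵀ * latentMatrix (X₀ n) -
      (m / 2 * n) • (1 : Matrix (Fin d) (Fin d) ℝ)).PosSemidef := by
  have h0 : Tendsto (fun n : ℕ => frobNorm
      ((1 / (n : ℝ)) • ((latentMatrix (X₀ n))ᵀ * latentMatrix (X₀ n)) - Δ)) atTop (𝓝 0) := by
    have h1 : frobNorm (0 : Matrix (Fin d) (Fin d) ℝ) = 0 := by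
      have : frobNorm (0 : Matrix (Fin d) (Fin d) ℝ) ^ 2 = 0 := by
        rw [frobNorm_sq_eq_sum]; simp
      exact pow_eq_zero_iff two_ne_zero |>.1 this
    have h2 := (continuous_frobNorm.tendsto _).comp (hlim.sub_const Δ)
    rwa [sub_self, h1] at h2
  filter_upwards [h0.eventually (gt_mem_nhds (half_pos hm)), eventually_ge_atTop 1] with n hn hn1
  have hn' : (0 : ℝ) < n := by exact_mod_cast hn1
  set G := (latentMatrix (X₀ n))ᵀ * latentMatrix (X₀ n) with hG
  refine Matrix.PosSemidef.of_dotProduct_mulVec_nonneg ?_ fun v => ?_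
  · refine Matrix.IsHermitian.sub ?_ (by simp [Matrix.IsHermitian])
    simpa [Matrix.conjTranspose_eq_transpose_of_trivial] using
      Matrix.isHermitian_conjTranspose_mul_self (latentMatrix (X₀ n))
  have h3 := abs_le.1 (abs_dotProduct_mulVec_le ((1 / (n : ℝ)) • G - Δ) v)
  have h4 := hΔ v
  have hv : 0 ≤ v ⬝ᵥ v := Finset.sum_nonneg fun i _ => mul_self_nonneg _
  have h5 := mul_le_mul_of_nonneg_right hn.le hv
  simp only [star_trivial, Matrix.sub_mulVec, dotProduct_sub, Matrix.smul_mulVec, dotProduct_smul,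
    Matrix.one_mulVec, smul_eq_mul] at h3 ⊢
  have h6 : m / 2 * (v ⬝ᵥ v) ≤ 1 / n * (v ⬝ᵥ G *ᵥ v) := by linarith [h3.1]
  have h7 := mul_le_mul_of_nonneg_left h6 hn'.le
  have h8 : (n : ℝ) * (1 / n * (v ⬝ᵥ G *ᵥ v)) = v ⬝ᵥ G *ᵥ v := by field_simp
  linarith

lemma procrustesLoss_le {n d : ℕ} (hn : 1 ≤ n) {X X₀ : Fin n → EuclideanSpace ℝ (Fin d)} {ρ M : ℝ}
    (hρ : 0 < ρ) (hZ : ((latentMatrix X₀)ᵀ * latentMatrix X₀ -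
      (ρ * n) • (1 : Matrix (Fin d) (Fin d) ℝ)).PosSemidef)
    (h : gramLoss X X₀ ≤ M / Real.sqrt n) : procrustesLoss X X₀ ≤ 2 * M ^ 2 / ρ / n := by
  have hn' : (0 : ℝ) < n := by exact_mod_cast hn
  rw [gramLoss_le_iff hn] at h
  obtain ⟨W, hW, hWle⟩ := exists_orthogonal_frobNorm_sub_le (latentMatrix X) (latentMatrix X₀) hZ
  have h1 : frobNorm (gramDiff X X₀) ^ 2 ≤ M ^ 2 * n := by
    have := pow_le_pow_left₀ (frobNorm_nonneg _) h 2
    rwa [mul_pow, Real.sq_sqrt hn'.le] at this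
  have h2 : frobNorm (latentMatrix X - latentMatrix X₀ * W) ^ 2 ≤ 2 * M ^ 2 / ρ := by
    rw [le_div_iff₀ hρ]
    have h3 : ρ * n / 2 * frobNorm (latentMatrix X - latentMatrix X₀ * W) ^ 2 ≤ M ^ 2 * n :=
      hWle.trans h1
    nlinarith
  have hmem : W ∈ Matrix.orthogonalGroup (Fin d) ℝ :=
    (Matrix.mem_orthogonalGroup_iff' (Fin d) ℝ).2 hW
  have h4 : ⨅ W : Matrix.orthogonalGroup (Fin d) ℝ,
      frobNorm (latentMatrix X - latentMatrix X₀ * (W : Matrix (Fin d) (Fin d) ℝ)) ^ 2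
      ≤ frobNorm (latentMatrix X - latentMatrix X₀ * W) ^ 2 :=
    ciInf_le ⟨0, by rintro _ ⟨W, rfl⟩; positivity⟩ (⟨W, hmem⟩ : Matrix.orthogonalGroup (Fin d) ℝ)
  rw [procrustesLoss, one_div, inv_mul_eq_div]
  gcongr
  exact h4.trans h2

end

theorem mainTheorem1 (d : ℕ) (f : EuclideanSpace ℝ (Fin d) → ℝ) (hf : IsPriorDensity f)
    (Δ : Matrix (Fin d) (Fin d) ℝ) (hΔ : Δ.PosDef) (δ : ℝ) (hδ : 0 < δ) (hδ' : δ < 1 / 2) :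
    ∃ M₁ M₂ : ℝ, 0 < M₁ ∧ 0 < M₂ ∧
      ∀ X₀ : (n : ℕ) → Fin n → EuclideanSpace ℝ (Fin d),
        (∀ n, X₀ n ∈ latentFamilies n d) →
        Tendsto (fun n : ℕ => (1 / (n : ℝ)) • ((latentMatrix (X₀ n))ᵀ * latentMatrix (X₀ n)))
          atTop (𝓝 Δ) →
        (∀ n i j, δ ≤ inner ℝ (X₀ n i) (X₀ n j) ∧ inner ℝ (X₀ n i) (X₀ n j) ≤ 1 - δ) →
        ∀ᶠ n : ℕ in atTop,
          ∀ (Ω : Type*) [MeasurableSpace Ω] (P : Measure Ω) [IsProbabilityMeasure P]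
            (Y : Ω → Matrix (Fin n) (Fin n) Bool), IsRDPG P (X₀ n) Y →
            ∫⁻ ω, rdpgPosterior f (X₀ n) (Y ω)
                {X | X ∈ latentFamilies n d ∧ gramLoss X (X₀ n) > M₁ / Real.sqrt n} ∂P
              ≤ ENNReal.ofReal (8 * Real.exp (-(1 / 2) * n * d)) ∧
            ∫⁻ ω, rdpgPosterior f (X₀ n) (Y ω)
                {X | X ∈ latentFamilies n d ∧ procrustesLoss X (X₀ n) > M₂ / n} ∂P
              ≤ ENNReal.ofReal (8 * Real.exp (-(1 / 2) * n * d)) := by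
  rcases Nat.eq_zero_or_pos d with rfl | hd
  · -- in dimension `0` all edge probabilities vanish
    refine ⟨1, 1, one_pos, one_pos, fun X₀ _ _ hb => ?_⟩
    have h := (hb 1 0 0).1
    rw [PiLp.inner_apply, Finset.univ_eq_empty, Finset.sum_empty] at h
    exact absurd hδ (not_lt.2 h)
  have hd' : (0 : ℝ) < d := by exact_mod_cast hd
  obtain ⟨a, b, ha, hb, hfa, hfb⟩ := hf.exists_bounds
  obtain ⟨m, hm, hmΔ⟩ := exists_pos_forall_le_dotProduct hΔ
  obtain ⟨κ, hκ⟩ : ∃ κ : ℝ, κ = 1 / (4096 * d ^ 2) := ⟨_, rfl⟩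
  have hκ0 : 0 < κ := by rw [hκ]; positivity
  obtain ⟨ρ, hρ⟩ : ∃ ρ, ρ = m / 2 := ⟨_, rfl⟩
  have hρ0 : 0 < ρ := by rw [hρ]; positivity
  obtain ⟨R, hR⟩ : ∃ R, R = b / a * (Real.sqrt (4 * Real.pi / (κ * ρ)) * (6 * d / δ)) ^ d :=
    ⟨_, rfl⟩
  have hR0 : 0 ≤ R := by rw [hR]; positivity
  -- `K` dominates both lower bounds on `K ^ 2` in `rate_bound`, as `1 ≤ K`
  set K : ℝ := 16 * (2 + R + 2 * d) + 8 * (2 + 9 * d) with hK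
  have hK1 : 1 ≤ K := by rw [hK]; linarith
  have hKsq : K ≤ K ^ 2 := by nlinarith
  refine ⟨16 * d * K, 2 * (16 * d * K) ^ 2 / ρ, by positivity, by positivity,
    fun X₀ hX₀ hlim hbd => ?_⟩
  filter_upwards [eventually_posSemidef_gram_sub hm hmΔ hlim, eventually_ge_atTop 1,
    eventually_poly_le_exp (d * d) (Real.exp (κ * ρ * d ^ 3 / 2))] with n hZ hn hpoly
  intro Ω _ P _ Y hY
  rw [← hρ] at hZ
  have hfirst : ∫⁻ ω, rdpgPosterior f (X₀ n) (Y ω) (farSet (X₀ n) (16 * d * K)) ∂P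
      ≤ ENNReal.ofReal (8 * Real.exp (-(1 / 2) * n * d)) :=
    (lintegral_posterior_farSet_le hn hd hf ha hb.le hfa hfb (hX₀ n) hδ hδ' (hbd n) hρ0
      (by linarith) hκ rfl hZ P Y hY).trans (ENNReal.ofReal_le_ofReal
        (rate_bound hn hd ha hb hδ hρ0 hκ0 rfl hR (by linarith) (by linarith) hpoly))
  refine ⟨hfirst, le_trans (lintegral_mono fun ω => ?_) hfirst⟩
  have hsub : {X | X ∈ latentFamilies n d ∧
      procrustesLoss X (X₀ n) > 2 * (16 * d * K) ^ 2 / ρ / n} ⊆ farSet (X₀ n) (16 * d * K) :=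
    fun X hX => ⟨hX.1, not_le.1 fun h => not_le.2 hX.2 (procrustesLoss_le hn hρ0 hZ h)⟩
  exact ENNReal.div_le_div_right (lintegral_mono_set hsub) _
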